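/- Let $p$ be a prime and let $(S,\mathcal F,\mathcal L)$ be a $p$-local compact group: $S$ is a discrete $p$-toral group, $\mathcal F$ is a saturated fusion system over $S$, and $\mathcal L$ is a centric linking system associated to $\mathcal F$, with projection $\pi\colon\mathcal L\to\mathcal F$. Let $P\le S$ be an $\mathcal F$-centric subgroup that is fully normalized in $\mathcal F$. Let $P\downarrow\mathcal L$ be the undercategory of $P$ in $\mathcal L$ (objects are the morphisms $P\to Q$ of $\mathcal L$, morphisms are the commuting triangles under $P$). For subgroups $Q,R\le N_SP$ let $\mathrm{Hom}_{N_{\mathcal F}P}(Q,R)$ be the set of those $\varphi\in\mathrm{Hom}_{\mathcal F}(Q,R)$ that extend to some $\varphi'\in\mathrm{Hom}_{\mathcal F}(QP,RP)$ with $\varphi'(P)=P$. Let $N_{\mathcal L}P$ be the category whose objects are the $N_{\mathcal F}P$-centric subgroups of $N_SP$ and whose morphisms $Q\to R$ are the $\varphi\in\mathrm{Hom}_{\mathcal L}(QP,RP)$ such that $\pi(\varphi)|_Q\in\mathrm{Hom}_{N_{\mathcal F}P}(Q,R)$ and $\pi(\varphi)(P)=P$. Let $P\downarrow N_{\mathcal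 L}P$ be the undercategory of $P$ in $N_{\mathcal L}P$, and let $i\colon(P\downarrow N_{\mathcal L}P)\to(P\downarrow\mathcal L)$ be the inclusion functor. Let $P\downarrow_{\not\cong}\mathcal L$ and $P\downarrow_{\not\cong}N_{\mathcal L}P$ be the full subcategories of $P\downarrow\mathcal L$ and $P\downarrow N_{\mathcal L}P$ on the objects $P\to Q$ that are not isomorphisms in $\mathcal L$. There exist families of morphisms $\iota_A^B\colon A\to B$ of $\mathcal L$, one for each pair of $\mathcal F$-centric subgroups $A\le B$ of $S$, which lift the inclusions and satisfy $\iota_A^A=\mathrm{id}$ and $\iota_B^C\circ\iota_A^B=\iota_A^C$. There also exist families of morphisms $F_\varphi\colon N_S(P_\varphi)\to N_SP$ of $\mathcal L$, one for each object $\varphi\colon P\to Q$ of $P\downarrow\mathcal L$, where $P_\varphi=\pi(\varphi)(P)$, such that $f_\varphi=\pi(F_\varphi)$ maps $P_\varphi$ onto $P$, and $F_\varphi=\mathrm{id}$ if $P_\varphi=P$. For every choice of such families there are a functor $$r\colon (P\downarrow\mathcal L)\to(P\downarrow N_{\mathcal L}P)$$ and a natural transformation $\eta\colon i\circ r\Rightarrow\mathrm{id}$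 such that the following hold. 1. For every $\varphi\colon P\to Q$, the target of $r(\varphi)$ is $T=f_\varphi(N_S(P_\varphi)\cap Q)$, and $$r(\varphi)=\iota_P^{T}\circ F_2\circ\varphi_0,\qquad \eta(\varphi)=\iota_{N_S(P_\varphi)\cap Q}^{Q}\circ F_1^{-1}\colon T\to Q,$$ where $\varphi_0\colon P\to P_\varphi$ is the corestriction of $\varphi$ (so $\iota_{P_\varphi}^{Q}\circ\varphi_0=\varphi$), and $F_1\colon N_S(P_\varphi)\cap Q\to T$ and $F_2\colon P_\varphi\to P$ are the isomorphisms of $\mathcal L$ obtained from $F_\varphi$ by restriction and corestriction along the morphisms $\iota$. 2. $r$ is a retraction: $r\circ i=\mathrm{id}$. 3. $r$ induces a homotopy equivalence of (geometrically realized) nerves $|P\downarrow\mathcal L|\to|P\downarrow N_{\mathcal L}P|$ with homotopy inverse $|i|$. 4. If $\varphi$ is not an isomorphism in $\mathcal L$, then neither is $r(\varphi)$. The restricted functors $$r'\colon (P\downarrow_{\not\cong}\mathcal L)\to(P\downarrow_{\not\cong}N_{\mathcal L}P),\qquad i'\colon (P\downarrow_{\not\cong}N_{\mathcal L}P)\to(P\downarrow_{\not\cong}\mathcal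 L)$$ satisfy $r'\circ i'=\mathrm{id}$, the transformation $\eta$ restricts to a natural transformation $i'\circ r'\Rightarrow\mathrm{id}$, and $|r'|\colon|P\downarrow_{\not\cong}\mathcal L|\to|P\downarrow_{\not\cong}N_{\mathcal L}P|$ is a homotopy equivalence with homotopy inverse $|i'|$. -/

import Mathlib

open CategoryTheory

universe u w

/-! ### Discrete `p`-toral groups -/

/-- The group `ℤ/p^∞`, realized as the `p`-primary part of `ℚ/ℤ`. -/
abbrev PruferGroup (p : ℕ) [Fact p.Prime] : Type :=
  AddCommGroup.primaryComponent (AddCircle (1 : ℚ)) p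

/-- `H` is an extension of a finite `p`-group of order `c` by `(ℤ/p^∞)^k`. -/
def HasToralSize (p : ℕ) [Fact p.Prime] (H : Type u) [Group H] (k c : ℕ) : Prop :=
  ∃ (T : Subgroup H) (_ : T.Normal),
    Nonempty (T ≃* Multiplicative (Fin k → PruferGroup p)) ∧
    Finite (H ⧸ T) ∧ IsPGroup p (H ⧸ T) ∧ Nat.card (H ⧸ T) = c

/-- Discrete `p`-toral groups. -/
def IsDiscretePToral (p : ℕ) [Fact p.Prime] (H : Type u) [Group H] : Prop :=
  ∃ k c : ℕ, HasToralSize p H k c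

open Classical in
/-- The size `(k, c)` of a discrete `p`-toral group: `k` is its rank and `c` is the number of its
components; sizes are ordered lexicographically. -/
noncomputable def toralSize (p : ℕ) [Fact p.Prime] (H : Type u) [Group H] : ℕ ×ₗ ℕ :=
  if h : ∃ a : ℕ × ℕ, HasToralSize p H a.1 a.2 then toLex h.choose else toLex (0, 0)

/-! ### Fusion systems -/

section Basic

variable {S : Type u} [Group S]

/-- The homomorphism `c_g : P → Q`, `x ↦ g x g⁻¹`, when `g P g⁻¹ ⊆ Q`. -/
def conjHom {P Q : Subgroup S} (g : S) (h : ∀ x ∈ P, g * x * g⁻¹ ∈ Q) : P →* Q :=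
  ((MulAut.conj g).toMonoidHom.comp P.subtype).codRestrict Q (fun x => h x x.2)

/-- The image of `φ : P → Q`, as a subgroup of `S`. -/
def imageOf {P Q : Subgroup S} (φ : P →* Q) : Subgroup S := (Q.subtype.comp φ).range

/-- The image `φ(A)` of those elements of the subgroup `A` of `S` that lie in the source `P`
of `φ : P → Q`, as a subgroup of `S`. -/
def imageOn {P Q : Subgroup S} (φ : P →* Q) (A : Subgroup S) : Subgroup S :=
  (A.subgroupOf P).map (Q.subtype.comp φ)

/-- The normalizer `N_S P`. -/
abbrev normS (P : Subgroup S) : Subgroup S := Subgroup.normalizer (P : Set S)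

/-- The centralizer `C_S P`. -/
abbrev centS (P : Subgroup S) : Subgroup S := Subgroup.centralizer (P : Set S)

theorem le_normS (P : Subgroup S) : P ≤ normS P := Subgroup.le_normalizer

/-- `Aut_S(P)`: the automorphisms of `P` given by conjugation by elements of `N_S P`. -/
def autS (P : Subgroup S) : Subgroup (MulAut P) where
  carrier := {α | ∃ g ∈ normS P, ∀ x : P, ((α x : P) : S) = g * x * g⁻¹}
  one_mem' := ⟨1, one_mem _, fun x => by simp⟩
  mul_mem' := by
    rintro α β ⟨g, hg, hα⟩ ⟨h, hh, hβ⟩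
    exact ⟨g * h, mul_mem hg hh, fun x => by simp [hα, hβ, mul_assoc]⟩
  inv_mem' := by
    rintro α ⟨g, hg, hα⟩
    refine ⟨g⁻¹, inv_mem hg, fun x => ?_⟩
    have h := hα (α⁻¹ x)
    rw [MulAut.apply_inv_self] at h
    rw [h]
    group

/-- `Aut_P(P)`: the inner automorphisms of `P`. -/
def innAut (P : Subgroup S) : Subgroup (MulAut P) := (MulAut.conj : P →* MulAut P).range

instance innAut_normal (P : Subgroup S) : (innAut P).Normal where
  conj_mem := by
    rintro _ ⟨x, rfl⟩ α
    exact ⟨α x, by ext y; simp⟩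

/-- For `φ : P → Q`, the group `N_φ` of all `g ∈ N_S P` such that
`φ ∘ c_g ∘ φ⁻¹ ∈ Aut_S(φ(P))`. -/
def extDomain {P Q : Subgroup S} (φ : P →* Q) : Subgroup S where
  carrier := {g | ∃ hg : g ∈ normS P, ∃ h ∈ normS (imageOf φ), ∀ x : P,
    (φ ⟨g * x * g⁻¹, (Subgroup.mem_normalizer_iff.1 hg x).1 x.2⟩ : S) = h * φ x * h⁻¹}
  one_mem' := ⟨one_mem _, 1, one_mem _, fun x => by simp⟩
  mul_mem' := by
    rintro a b ⟨ha, h, hh, hha⟩ ⟨hb, k, hk, hkb⟩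
    refine ⟨mul_mem ha hb, h * k, mul_mem hh hk, fun x => ?_⟩
    have h1 := hha ⟨b * x * b⁻¹, (Subgroup.mem_normalizer_iff.1 hb x).1 x.2⟩
    rw [hkb x] at h1
    simpa [mul_assoc] using h1
  inv_mem' := by
    rintro a ⟨ha, h, hh, hha⟩
    refine ⟨inv_mem ha, h⁻¹, inv_mem hh, fun x => ?_⟩
    have h1 := hha ⟨a⁻¹ * x * a⁻¹⁻¹, (Subgroup.mem_normalizer_iff.1 (inv_mem ha) x).1 x.2⟩
    have h2 : (⟨a * (a⁻¹ * x * a⁻¹⁻¹) * a⁻¹, (Subgroup.mem_normalizer_iff.1 ha _).1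
        ((Subgroup.mem_normalizer_iff.1 (inv_mem ha) x).1 x.2)⟩ : P) = x := by
      ext; simp [mul_assoc]
    simp only at h1
    rw [h2] at h1
    rw [h1]
    group

theorem le_extDomain {P Q : Subgroup S} (φ : P →* Q) : P ≤ extDomain φ := by
  intro g hg
  refine ⟨le_normS P hg, φ ⟨g, hg⟩, le_normS _ ⟨⟨g, hg⟩, rfl⟩, fun x => ?_⟩
  have : (⟨g * x * g⁻¹, (Subgroup.mem_normalizer_iff.1 (le_normS P hg) x).1 x.2⟩ : P)
      = ⟨g, hg⟩ * x * ⟨g, hg⟩⁻¹ := rfl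
  rw [this]
  simp

end Basic

/-- A fusion system over `S`: its objects are all subgroups of `S`, and its morphism sets consist
of injective homomorphisms, contain all conjugations by elements of `S`, and every morphism is an
isomorphism of the system followed by an inclusion. (Identities are conjugations by `1`.) -/
structure FusionSystem (S : Type u) [Group S] where
  Hom (P Q : Subgroup S) : Set (P →* Q)
  injective {P Q : Subgroup S} {φ : P →* Q} : φ ∈ Hom P Q → Function.Injective φ
  comp_mem {P Q R : Subgroup S} {φ : P →* Q} {ψ : Q →* R} :
    φ ∈ Hom P Q → ψ ∈ Hom Q R → ψ.comp φ ∈ Hom P R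
  conj_mem {P Q : Subgroup S} (g : S) (h : ∀ x ∈ P, g * x * g⁻¹ ∈ Q) : conjHom g h ∈ Hom P Q
  factor {P Q : Subgroup S} {φ : P →* Q} : φ ∈ Hom P Q →
    ∃ (R : Subgroup S) (hR : R ≤ Q) (e : P ≃* R), e.toMonoidHom ∈ Hom P R ∧
      e.symm.toMonoidHom ∈ Hom R P ∧ φ = (Subgroup.inclusion hR).comp e.toMonoidHom

namespace FusionSystem

variable {S : Type u} [Group S] (F : FusionSystem S)

theorem inclusion_mem {P Q : Subgroup S} (h : P ≤ Q) : Subgroup.inclusion h ∈ F.Hom P Q := by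
  have := F.conj_mem (P := P) (Q := Q) 1 (fun x hx => by simpa using h hx)
  convert this using 1
  ext x
  simp [conjHom]

theorem id_mem (P : Subgroup S) : MonoidHom.id P ∈ F.Hom P P := F.inclusion_mem le_rfl

/-- `P` and `Q` are `F`-conjugate, i.e. isomorphic in `F`. -/
def IsConj (P Q : Subgroup S) : Prop :=
  ∃ e : P ≃* Q, e.toMonoidHom ∈ F.Hom P Q ∧ e.symm.toMonoidHom ∈ F.Hom Q P

/-- `P` is fully centralized in `F`. -/
def IsFullyCentralized (p : ℕ) [Fact p.Prime] (P : Subgroup S) : Prop :=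
  ∀ Q : Subgroup S, F.IsConj P Q → toralSize p (centS Q) ≤ toralSize p (centS P)

/-- `P` is fully normalized in `F`. -/
def IsFullyNormalized (p : ℕ) [Fact p.Prime] (P : Subgroup S) : Prop :=
  ∀ Q : Subgroup S, F.IsConj P Q → toralSize p (normS Q) ≤ toralSize p (normS P)

/-- `P` is `F`-centric: every subgroup `F`-conjugate to `P` (in particular `P` itself) contains its
centralizer in `S`. -/
def IsCentric (P : Subgroup S) : Prop :=
  ∀ Q : Subgroup S, F.IsConj P Q → centS Q ≤ Q

/-- `Aut_F(P)`. -/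
def aut (P : Subgroup S) : Subgroup (MulAut P) where
  carrier := {α | α.toMonoidHom ∈ F.Hom P P ∧ α.symm.toMonoidHom ∈ F.Hom P P}
  one_mem' := ⟨F.id_mem P, F.id_mem P⟩
  mul_mem' := fun ha hb => ⟨F.comp_mem hb.1 ha.1, F.comp_mem ha.2 hb.2⟩
  inv_mem' := fun ha => ⟨ha.2, ha.1⟩

/-- `Out_F(P) = Aut_F(P) / Aut_P(P)`. -/
abbrev Out (P : Subgroup S) : Type u := F.aut P ⧸ (innAut P).subgroupOf (F.aut P)

/-- `Out_S(P)`, as a subgroup of `Out_F(P)`. -/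
def outS (P : Subgroup S) : Subgroup (F.Out P) :=
  ((autS P).subgroupOf (F.aut P)).map (QuotientGroup.mk' ((innAut P).subgroupOf (F.aut P)))

/-- Saturated fusion systems. -/
structure IsSaturated (p : ℕ) [Fact p.Prime] : Prop where
  sylow (P : Subgroup S) : F.IsFullyNormalized p P →
    F.IsFullyCentralized p P ∧ Finite (F.Out P) ∧
      ∃ T : Sylow p (F.Out P), (T : Subgroup (F.Out P)) = F.outS P
  extend (P : Subgroup S) (φ : P →* (⊤ : Subgroup S)) : φ ∈ F.Hom P ⊤ →
    F.IsFullyCentralized p (imageOf φ) →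
      ∃ ψ ∈ F.Hom (extDomain φ) ⊤, ψ.comp (Subgroup.inclusion (le_extDomain φ)) = φ
  union (P : ℕ → Subgroup S) : Monotone P → ∀ φ : (⨆ n, P n : Subgroup S) →* (⊤ : Subgroup S),
    (∀ n, φ.comp (Subgroup.inclusion (le_iSup P n)) ∈ F.Hom (P n) ⊤) →
      φ ∈ F.Hom (⨆ n, P n) ⊤

/-- The `F`-centric subgroups of `S`. -/
@[ext]
structure CentricSubgroup where
  grp : Subgroup S
  centric : F.IsCentric grp

variable {F}

theorem IsConj.trans {P Q R : Subgroup S} (h : F.IsConj P Q) (h' : F.IsConj Q R) :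
    F.IsConj P R := by
  obtain ⟨e, he, he'⟩ := h
  obtain ⟨f, hf, hf'⟩ := h'
  exact ⟨e.trans f, F.comp_mem he hf, F.comp_mem hf' he'⟩

theorem isConj_imageOf {P Q : Subgroup S} {φ : P →* Q} (h : φ ∈ F.Hom P Q) :
    F.IsConj P (imageOf φ) := by
  obtain ⟨R, hR, e, he, he', rfl⟩ := F.factor h
  have : imageOf ((Subgroup.inclusion hR).comp e.toMonoidHom) = R := by
    ext x
    constructor
    · rintro ⟨y, rfl⟩
      exact (e y).2
    · intro hx
      exact ⟨e.symm ⟨x, hx⟩, by simp⟩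
  rw [this]
  exact ⟨e, he, he'⟩

theorem IsCentric.of_conj {P Q : Subgroup S} (hP : F.IsCentric P) (h : F.IsConj P Q) :
    F.IsCentric Q := fun R hR => hP R (h.trans hR)

theorem IsCentric.of_le {P Q : Subgroup S} (hP : F.IsCentric P) (h : P ≤ Q) :
    F.IsCentric Q := by
  rintro R ⟨e, he, -⟩
  have hc := F.comp_mem (F.inclusion_mem h) he
  have h1 : imageOf (e.toMonoidHom.comp (Subgroup.inclusion h)) ≤ R := by
    rintro _ ⟨y, rfl⟩
    exact (e _).2
  exact (Subgroup.centralizer_le h1).trans ((hP _ (isConj_imageOf hc)).trans h1)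

variable (F)

/-- The morphism sets of the normalizer `N_F P`, for subgroups `Q`, `R` of `N_S P`: the morphisms
`Q → R` of `F` that extend to a morphism `Q · P → R · P` of `F` taking `P` onto `P`.
(As `Q` normalizes `P`, the product `Q · P` is the join `Q ⊔ P`.) -/
def normHom (P Q R : Subgroup S) : Set (Q →* R) :=
  {φ | φ ∈ F.Hom Q R ∧ ∃ φ' ∈ F.Hom (Q ⊔ P) (R ⊔ P),
    (∀ x : Q, (φ' (Subgroup.inclusion le_sup_left x) : S) = φ x) ∧ imageOn φ' P = P}

/-- `Q` and `R` are isomorphic in `N_F P`. -/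
def IsNormConj (P Q R : Subgroup S) : Prop :=
  ∃ e : Q ≃* R, e.toMonoidHom ∈ F.normHom P Q R ∧ e.symm.toMonoidHom ∈ F.normHom P R Q

/-- The subgroup `Q` of `N_S P` is `N_F P`-centric: every subgroup `R` of `N_S P` isomorphic to `Q`
in `N_F P` contains its centralizer in `N_S P`. -/
def IsNormCentric (P Q : Subgroup S) : Prop :=
  ∀ R ≤ normS P, F.IsNormConj P Q R → centS R ⊓ normS P ≤ R

theorem imageOn_comp {P Q R A B : Subgroup S} {φ : P →* Q} {ψ : Q →* R}
    (hφ : imageOn φ A = B) (hψ : imageOn ψ B = B) : imageOn (ψ.comp φ) A = B := by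
  rw [← hψ]
  ext z
  constructor
  · rintro ⟨x, hx, rfl⟩
    exact ⟨φ x, hφ.le ⟨x, hx, rfl⟩, rfl⟩
  · rintro ⟨y, hy, rfl⟩
    obtain ⟨x, hx, hxy⟩ := hφ.ge hy
    exact ⟨x, hx, by
      have : φ x = y := Subtype.ext hxy
      simp [this]⟩

theorem imageOn_id {Q P : Subgroup S} (h : P ≤ Q) : imageOn (MonoidHom.id Q) P = P := by
  ext z
  constructor
  · rintro ⟨x, hx, rfl⟩
    exact hx
  · intro hz
    exact ⟨⟨z, h hz⟩, hz, rfl⟩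

theorem normHom_id (P Q : Subgroup S) : MonoidHom.id Q ∈ F.normHom P Q Q :=
  ⟨F.id_mem Q, MonoidHom.id _, F.id_mem _, fun _ => rfl, imageOn_id le_sup_right⟩

theorem normHom_comp {P Q R T : Subgroup S} {φ : Q →* R} {ψ : R →* T}
    (hφ : φ ∈ F.normHom P Q R) (hψ : ψ ∈ F.normHom P R T) : ψ.comp φ ∈ F.normHom P Q T := by
  obtain ⟨h1, φ', h2, h3, h4⟩ := hφ
  obtain ⟨k1, ψ', k2, k3, k4⟩ := hψ
  refine ⟨F.comp_mem h1 k1, ψ'.comp φ', F.comp_mem h2 k2, fun x => ?_, imageOn_comp h4 k4⟩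
  have : φ' (Subgroup.inclusion le_sup_left x) = Subgroup.inclusion le_sup_left (φ x) :=
    Subtype.ext (h3 x)
  simp [this, k3]

theorem IsCentric.isNormCentric {F : FusionSystem S} {P Q : Subgroup S} (hQ : F.IsCentric Q) :
    F.IsNormCentric P Q := by
  rintro R - ⟨e, he, he'⟩
  exact inf_le_left.trans (hQ R ⟨e, he.1, he'.1⟩)

end FusionSystem

/-! ### Centric linking systems -/

/-- A centric linking system associated to `F`: a category whose objects are the `F`-centric
subgroups of `S`, with a functor `π` to `F` that is the identity on objects, and injective
homomorphisms `δ P : P → Aut(P)`. In Mathlib, `f ≫ g` is the composite `g ∘ f`, and multiplication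
in `Aut P` is `f * g = f ∘ g`. -/
structure CentricLinkingSystem {S : Type u} [Group S] (F : FusionSystem S) where
  [cat : Category.{w} F.CentricSubgroup]
  /-- The functor `π` on morphisms. -/
  π {P Q : F.CentricSubgroup} (f : P ⟶ Q) : P.grp →* Q.grp
  π_mem {P Q : F.CentricSubgroup} (f : P ⟶ Q) : π f ∈ F.Hom P.grp Q.grp
  π_id (P : F.CentricSubgroup) : π (𝟙 P) = MonoidHom.id P.grp
  π_comp {P Q R : F.CentricSubgroup} (f : P ⟶ Q) (g : Q ⟶ R) : π (f ≫ g) = (π g).comp (π f)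
  /-- The distinguished monomorphisms. -/
  δ (P : F.CentricSubgroup) : P.grp →* Aut P
  δ_injective (P : F.CentricSubgroup) : Function.Injective (δ P)
  /-- `Z(P)` acts freely on the morphisms from `P`. -/
  free {P Q : F.CentricSubgroup} (f : P ⟶ Q) (z : P.grp) :
    z ∈ Subgroup.center P.grp → (δ P z).hom ≫ f = f → z = 1
  /-- `π` is surjective onto the morphism sets of `F`. -/
  π_surj {P Q : F.CentricSubgroup} (φ : P.grp →* Q.grp) : φ ∈ F.Hom P.grp Q.grp → ∃ f : P ⟶ Q, π f = φ
  /-- The fibres of `π` are the orbits of `Z(P)`. -/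
  π_eq_iff {P Q : F.CentricSubgroup} (f g : P ⟶ Q) :
    π f = π g ↔ ∃ z ∈ Subgroup.center P.grp, g = (δ P z).hom ≫ f
  π_δ (P : F.CentricSubgroup) (g x : P.grp) : π (δ P g).hom x = g * x * g⁻¹
  δ_comm {P Q : F.CentricSubgroup} (f : P ⟶ Q) (g : P.grp) :
    (δ P g).hom ≫ f = f ≫ (δ Q (π f g)).hom

namespace CentricLinkingSystem

variable {S : Type u} [Group S] {F : FusionSystem S} (L : CentricLinkingSystem.{u, w} F)

/-- The objects of `L`. -/
@[nolint unusedArguments]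
def Obj (_ : CentricLinkingSystem.{u, w} F) : Type u := F.CentricSubgroup

instance : Category.{w} L.Obj := L.cat

variable {L}

/-- The subgroup of `S` underlying an object of `L`. -/
def Obj.grp (P : L.Obj) : Subgroup S := FusionSystem.CentricSubgroup.grp P

theorem Obj.centric (P : L.Obj) : F.IsCentric P.grp := FusionSystem.CentricSubgroup.centric P

/-- The homomorphism `π(f)` of `F` underlying a morphism `f` of `L`. -/
def proj {P Q : L.Obj} (f : P ⟶ Q) : P.grp →* Q.grp := L.π f

theorem proj_mem {P Q : L.Obj} (f : P ⟶ Q) : proj f ∈ F.Hom P.grp Q.grp := L.π_mem f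

theorem proj_id (P : L.Obj) : proj (𝟙 P) = MonoidHom.id P.grp := L.π_id P

theorem proj_comp {P Q R : L.Obj} (f : P ⟶ Q) (g : Q ⟶ R) :
    proj (f ≫ g) = (proj g).comp (proj f) := L.π_comp f g

/-- An overgroup of an object of `L`, as an object of `L`. -/
def Obj.over (P : L.Obj) (Q : Subgroup S) (h : P.grp ≤ Q) : L.Obj :=
  ⟨Q, FusionSystem.IsCentric.of_le P.centric h⟩

/-- `N_S P`, as an object of `L`. -/
def Obj.norm (P : L.Obj) : L.Obj := P.over (normS P.grp) (le_normS P.grp)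

/-- For `φ : P → Q` in `L`, the object `P_φ = π(φ)(P)`. -/
def imageObj {P Q : L.Obj} (φ : P ⟶ Q) : L.Obj :=
  ⟨imageOf (proj φ), FusionSystem.IsCentric.of_conj P.centric
    (FusionSystem.isConj_imageOf (proj_mem φ))⟩

theorem imageObj_le {P Q : L.Obj} (φ : P ⟶ Q) : (imageObj φ).grp ≤ Q.grp := by
  rintro _ ⟨x, rfl⟩
  exact (proj φ x).2

/-- For `φ : P → Q` in `L`, the object `N_S(P_φ) ∩ Q`. -/
def normInObj {P Q : L.Obj} (φ : P ⟶ Q) : L.Obj :=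
  (imageObj φ).over (normS (imageObj φ).grp ⊓ Q.grp) (le_inf (le_normS _) (imageObj_le φ))

variable (L)

/-- A compatible choice of morphisms `ι_P^Q : P → Q` in `L` lifting the inclusions `P ⊆ Q`. -/
structure Inclusions where
  ι {P Q : L.Obj} (h : P.grp ≤ Q.grp) : P ⟶ Q
  proj_ι {P Q : L.Obj} (h : P.grp ≤ Q.grp) : proj (ι h) = Subgroup.inclusion h
  ι_refl (P : L.Obj) : ι (le_refl P.grp) = 𝟙 P
  ι_trans {P Q R : L.Obj} (h : P.grp ≤ Q.grp) (h' : Q.grp ≤ R.grp) :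
    ι h ≫ ι h' = ι (h.trans h')

variable {L}

/-! ### The normalizer `N_L P` and the undercategories -/

/-- The objects of `N_L P`: the `N_F P`-centric subgroups of `N_S P`. -/
structure NormObj (P : L.Obj) where
  grp : Subgroup S
  le_norm : grp ≤ normS P.grp
  centric : F.IsNormCentric P.grp grp

/-- The object `Q · P` of `L`, for an object `Q` of `N_L P`. -/
def NormObj.prod {P : L.Obj} (Q : NormObj P) : L.Obj := P.over (Q.grp ⊔ P.grp) le_sup_right

theorem NormObj.prod_le {P : L.Obj} (Q : NormObj P) : Q.prod.grp ≤ P.norm.grp :=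
  sup_le Q.le_norm (le_normS P.grp)

theorem NormObj.le_prod {P : L.Obj} (Q : NormObj P) : P.grp ≤ Q.prod.grp :=
  le_sup_right (a := Q.grp)

theorem NormObj.grp_le_prod {P : L.Obj} (Q : NormObj P) : Q.grp ≤ Q.prod.grp :=
  le_sup_left (b := P.grp)

/-- `φ : Q · P → R · P` in `L` is a morphism `Q → R` of `N_L P`: the restriction of `π(φ)` to `Q` is
a morphism `Q → R` of `N_F P`, and `π(φ)(P) = P`. -/
def IsNormMor {P : L.Obj} (Q R : NormObj P) (φ : Q.prod ⟶ R.prod) : Prop :=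
  (∃ ψ ∈ F.normHom P.grp Q.grp R.grp,
    ∀ x : Q.grp, (proj φ (Subgroup.inclusion Q.grp_le_prod x) : S) = ψ x) ∧
  imageOn (proj φ) P.grp = P.grp

/-- The category `N_L P`. -/
instance (P : L.Obj) : Category.{w} (NormObj P) where
  Hom Q R := {φ : Q.prod ⟶ R.prod // IsNormMor Q R φ}
  id Q := ⟨𝟙 _, ⟨MonoidHom.id _, F.normHom_id _ _, fun x => by rw [proj_id]; rfl⟩, by
    rw [proj_id]
    exact FusionSystem.imageOn_id Q.le_prod⟩
  comp {Q R T} f g := ⟨f.1 ≫ g.1, by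
    obtain ⟨f, ⟨ψ, hψ, h1⟩, h2⟩ := f
    obtain ⟨g, ⟨χ, hχ, k1⟩, k2⟩ := g
    rw [IsNormMor, proj_comp]
    refine ⟨⟨χ.comp ψ, F.normHom_comp hψ hχ, fun x => ?_⟩, FusionSystem.imageOn_comp h2 k2⟩
    have : proj f (Subgroup.inclusion Q.grp_le_prod x) =
        Subgroup.inclusion R.grp_le_prod (ψ x) := Subtype.ext (h1 x)
    rw [MonoidHom.comp_apply, MonoidHom.comp_apply, this, k1]⟩
  id_comp f := Subtype.ext (Category.id_comp f.1)
  comp_id f := Subtype.ext (Category.comp_id f.1)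
  assoc f g h := Subtype.ext (Category.assoc f.1 g.1 h.1)

/-- `P`, as an object of `N_L P`. -/
def Obj.inNorm (P : L.Obj) : NormObj P where
  grp := P.grp
  le_norm := le_normS P.grp
  centric := FusionSystem.IsCentric.isNormCentric P.centric

theorem Obj.eq_prod (P : L.Obj) : P = P.inNorm.prod :=
  FusionSystem.CentricSubgroup.ext (sup_idem P.grp).symm

/-- The undercategory `P ↓ N_L P`. -/
abbrev NormUnder (P : L.Obj) := Under P.inNorm

/-- The inclusion functor `i : (P ↓ N_L P) ⥤ (P ↓ L)`. It regards `P → Q` in `N_L P`, which is a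
morphism `P · P → Q · P` of `L`, as a morphism of `L` with source `P = P · P`; here `Q · P = Q`
since `Q` contains `P`. -/
def underIncl (P : L.Obj) : NormUnder P ⥤ Under P where
  obj φ := Under.mk (eqToHom P.eq_prod ≫ φ.hom.1)
  map {φ ψ} f := Under.homMk f.right.1 (by
    have h : φ.hom ≫ f.right = ψ.hom := Under.w f
    have h' : φ.hom.1 ≫ f.right.1 = ψ.hom.1 := congrArg Subtype.val h
    simp [h'])
  map_id φ := by ext; rfl
  map_comp f g := by ext; rfl

/-- The objects of `P ↓ L` that are not isomorphisms of `L`. -/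
def nonIso (P : L.Obj) : ObjectProperty (Under P) := fun φ => ¬ IsIso φ.hom

/-- The objects of `P ↓ N_L P` that are not isomorphisms of `L`. -/
def normNonIso (P : L.Obj) : ObjectProperty (NormUnder P) :=
  fun φ => ¬ IsIso ((underIncl P).obj φ).hom

/-- The full subcategory of `P ↓ L` of non-isomorphisms. -/
abbrev UnderNonIso (P : L.Obj) := (nonIso P).FullSubcategory

/-- The full subcategory of `P ↓ N_L P` of non-isomorphisms. -/
abbrev NormUnderNonIso (P : L.Obj) := (normNonIso P).FullSubcategory

/-- The restriction of the inclusion functor to non-isomorphisms. -/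
def underInclNonIso (P : L.Obj) : NormUnderNonIso P ⥤ UnderNonIso P :=
  (nonIso P).lift ((normNonIso P).ι ⋙ underIncl P) (fun φ => φ.property)

/-- The restriction to non-isomorphisms of a functor that preserves non-isomorphisms. -/
def restrictNonIso {P : L.Obj} (r : Under P ⥤ NormUnder P)
    (hr : ∀ φ, nonIso P φ → normNonIso P (r.obj φ)) : UnderNonIso P ⥤ NormUnderNonIso P :=
  (normNonIso P).lift ((nonIso P).ι ⋙ r) (fun φ => hr φ.obj φ.property)

/-! ### The retraction -/

/-- The choices made in the construction of the retraction: for every object `φ : P → Q` of `P ↓ L`,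
a morphism `F_φ : N_S(P_φ) → N_S P` of `L` whose underlying homomorphism `f_φ` maps `P_φ` onto `P`,
and which is the identity if `P_φ = P`. -/
structure RetractionChoice (P : L.Obj) where
  lift (φ : Under P) : (imageObj φ.hom).norm ⟶ P.norm
  image_eq (φ : Under P) : imageOn (proj (lift φ)) (imageObj φ.hom).grp = P.grp
  lift_eq_id (φ : Under P) (h : imageObj φ.hom = P) : lift φ = eqToHom (congrArg Obj.norm h)

/-- The object `ρ` of `P ↓ N_L P` and the morphism `η : ρ → φ` of `P ↓ L` are those constructed from
the object `φ : P → Q` and the chosen morphism `F_φ`: the target of `ρ` is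
`T = f_φ(N_S(P_φ) ∩ Q)`, and if `φ₀ : P → P_φ` is the corestriction of `φ`, and
`F₁ : N_S(P_φ) ∩ Q ≅ T` and `F₂ : P_φ ≅ P` are the isomorphisms obtained by restricting and
corestricting `F_φ`, then `ρ = ι_P^T ∘ F₂ ∘ φ₀` and `η = ι ∘ F₁⁻¹ : T → N_S(P_φ) ∩ Q → Q`. -/
def IsRetractionAt {P : L.Obj} (I : L.Inclusions) (c : RetractionChoice P) (φ : Under P)
    (ρ : NormUnder P) (η : (underIncl P).obj ρ ⟶ φ) : Prop :=
  ρ.right.grp = imageOn (proj (c.lift φ)) (normInObj φ.hom).grp ∧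
  ∃ (φ₀ : P ⟶ imageObj φ.hom) (F₁ : normInObj φ.hom ≅ ρ.right.prod) (F₂ : imageObj φ.hom ≅ P),
    φ₀ ≫ I.ι (imageObj_le φ.hom) = φ.hom ∧
    F₁.hom ≫ I.ι ρ.right.prod_le =
      I.ι (Q := (imageObj φ.hom).norm) (inf_le_left (b := φ.right.grp)) ≫ c.lift φ ∧
    F₂.hom ≫ I.ι (Q := P.norm) (le_normS P.grp) =
      I.ι (Q := (imageObj φ.hom).norm) (le_normS _) ≫ c.lift φ ∧
    ((underIncl P).obj ρ).hom = φ₀ ≫ F₂.hom ≫ I.ι ρ.right.le_prod ∧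
    η.right = F₁.inv ≫ I.ι (inf_le_right (a := normS (imageObj φ.hom).grp))

end CentricLinkingSystem

/-! ### Homotopy equivalences of nerves -/

/-- The continuous map `|C| → |D|` induced by a functor on geometric realizations of nerves. -/
noncomputable def nerveRealization {C D : Type u} [Category.{w} C] [Category.{w} D] (G : C ⥤ D) :
    C(SSet.toTop.obj (nerve C), SSet.toTop.obj (nerve D)) :=
  (SSet.toTop.map (nerveMap G)).hom

/-- `G` induces a homotopy equivalence of nerves, with homotopy inverse induced by `H`. -/
def IsNerveEquivWithInverse {C D : Type u} [Category.{w} C] [Category.{w} D]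
    (G : C ⥤ D) (H : D ⥤ C) : Prop :=
  ((nerveRealization H).comp (nerveRealization G)).Homotopic (ContinuousMap.id _) ∧
  ((nerveRealization G).comp (nerveRealization H)).Homotopic (ContinuousMap.id _)

open CentricLinkingSystem

/-!
The functor `r` is right adjoint to the inclusion `i`, with counit `η`. If `σ` is an object of
`P ↓ N_L P`, its target normalizes `P`, so a morphism from `i(σ)` to `φ : P → Q` takes this target
into `N_S(P_φ) ∩ Q`, which is the image of `η(φ)`. Morphisms of `L` are monomorphisms and lift along
one another when their images are nested, so every morphism `i(σ) → φ` factors uniquely through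
`η(φ)`, and the functoriality of `r` follows. That `r(φ)` is not an isomorphism when `φ` is not one
holds because normalizers grow in discrete `p`-toral groups: if `P_φ < Q`, then
`P_φ < N_S(P_φ) ∩ Q`. Finally, a natural transformation induces a homotopy of maps between the
realizations of the nerves, built from the triangulation of the prisms `|Δⁿ| × [0, 1]`.
-/

section NerveRealization

open Simplicial Opposite

section OrderComplex

variable {X Y P Q : Type*} [Fintype X] [Fintype Y] [Fintype P] [Fintype Q]

theorem stdSimplex_map_apply [DecidableEq Y] (f : X → Y) (v : stdSimplex ℝ X) (y : Y) :
    stdSimplex.map f v y = ∑ x with f x = y, v x :=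
  FunOnFinite.linearMap_apply_apply ℝ ℝ f v y

theorem sum_stdSimplex_map [DecidableEq Y] (f : X → Y) (v : stdSimplex ℝ X) (A : Finset Y) :
    ∑ y ∈ A, stdSimplex.map f v y = ∑ x with f x ∈ A, v x := by
  rw [← Finset.sum_fiberwise_of_maps_to (t := A) (g := f) fun x hx => by simpa using hx]
  refine Finset.sum_congr rfl fun y hy => ?_
  rw [stdSimplex_map_apply, Finset.filter_filter]
  exact Finset.sum_congr (Finset.filter_congr fun x _ => by grind) fun _ _ => rfl

theorem stdSimplex_map_apply_of_injective {f : X → Y} (hf : f.Injective) (v : stdSimplex ℝ X)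
    (x : X) : stdSimplex.map f v (f x) = v x := by
  classical
  simp [stdSimplex_map_apply, hf.eq_iff, Finset.sum_filter]

theorem stdSimplex_map_injective {f : X → Y} (hf : f.Injective) :
    (stdSimplex.map f : stdSimplex ℝ X → stdSimplex ℝ Y).Injective := fun v w h =>
  DFunLike.ext _ _ fun x => by
    rw [← stdSimplex_map_apply_of_injective hf, h, stdSimplex_map_apply_of_injective hf]

theorem support_stdSimplex_map (f : X → Y) (v : stdSimplex ℝ X) :
    Function.support (stdSimplex.map f v) = f '' Function.support v := by
  classical
  ext y
  rw [Function.mem_support, stdSimplex_map_apply, Ne,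
    Finset.sum_eq_zero_iff_of_nonneg fun _ _ => stdSimplex.zero_le _ _]
  simp [and_comm]

/-- Restriction of barycentric coordinates to a face that carries the point. -/
def faceCoord (b : X ↪ Y) (w : {w : stdSimplex ℝ Y // Function.support w ⊆ Set.range b}) :
    stdSimplex ℝ X :=
  ⟨fun x => w.1 (b x), fun x => stdSimplex.zero_le w.1 (b x),
    (Finset.sum_of_injOn (g := w.1) b b.injective.injOn (fun _ _ => Finset.mem_univ _)
      (fun y _ hy => Function.notMem_support.1 (mt (@w.2 y) (by simpa using hy)))
      fun _ _ => rfl).trans (stdSimplex.sum_eq_one w.1)⟩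

theorem map_faceCoord (b : X ↪ Y)
    (w : {w : stdSimplex ℝ Y // Function.support w ⊆ Set.range b}) :
    stdSimplex.map b (faceCoord b w) = w.1 := by
  refine DFunLike.ext _ _ fun y => ?_
  by_cases hy : y ∈ Set.range b
  · obtain ⟨x, rfl⟩ := hy
    exact stdSimplex_map_apply_of_injective b.injective (faceCoord b w) x
  · have h : y ∉ Function.support (stdSimplex.map b (faceCoord b w)) := by
      rw [support_stdSimplex_map]
      exact fun hy' => hy (Set.image_subset_range _ _ hy')
    exact (Function.notMem_support.1 h).trans (Function.notMem_support.1 (mt (@w.2 y) hy)).symm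

theorem continuous_faceCoord (b : X ↪ Y) : Continuous (faceCoord b) :=
  Continuous.subtype_mk (continuous_pi fun x =>
    (continuous_apply (b x)).comp (continuous_subtype_val.comp continuous_subtype_val))
    fun w => (faceCoord b w).2

omit [Fintype P] in
theorem exists_orderEmbedding_range_eq [PartialOrder P] {s : Finset P}
    (hs : IsChain (· ≤ ·) (s : Set P)) (h : s.Nonempty) :
    ∃ (m : ℕ) (b : Fin (m + 1) ↪o P), Set.range b = s := by
  classical
  let := hs.linearOrder
  obtain ⟨m, hm⟩ := Nat.exists_eq_succ_of_ne_zero h.card_ne_zero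
  let e : Fin (m + 1) ≃o s := Fintype.orderIsoFinOfCardEq s (by simpa using hm)
  refine ⟨m, e.toOrderEmbedding.trans (OrderEmbedding.subtype _), ?_⟩
  rw [RelEmbedding.coe_trans, Set.range_comp]
  change Subtype.val '' Set.range e = _
  rw [e.surjective.range_eq, Set.image_univ, Subtype.range_coe]

/-- The geometric realization of the order complex of a finite poset `P`, in barycentric
coordinates. -/
def OrderComplex (P : Type*) [Fintype P] [PartialOrder P] : Set (stdSimplex ℝ P) :=
  {w | IsChain (· ≤ ·) (Function.support w)}

variable [PartialOrder P] [PartialOrder Q]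

theorem map_mem_orderComplex (f : P →o Q) {w : stdSimplex ℝ P} (hw : w ∈ OrderComplex P) :
    stdSimplex.map f w ∈ OrderComplex Q := by
  rw [OrderComplex, Set.mem_ofPred_eq, support_stdSimplex_map]
  exact hw.image f

theorem mem_orderComplex_of_linearOrder {ι : Type*} [Fintype ι] [LinearOrder ι]
    (w : stdSimplex ℝ ι) : w ∈ OrderComplex ι :=
  fun i _ j _ _ => le_total i j

theorem stdSimplex_support_nonempty (w : stdSimplex ℝ X) : (Function.support w).Nonempty := by
  by_contra! h
  have := stdSimplex.sum_eq_one w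
  rw [Function.support_eq_empty_iff.1 h] at this
  simp at this

theorem exists_map_eq_of_mem_orderComplex {w : stdSimplex ℝ P} (hw : w ∈ OrderComplex P) :
    ∃ (m : ℕ) (b : Fin (m + 1) ↪o P) (v : stdSimplex ℝ (Fin (m + 1))),
      stdSimplex.map b v = w ∧ ∀ i, v i ≠ 0 := by
  classical
  obtain ⟨m, b, hb⟩ := exists_orderEmbedding_range_eq (s := (Function.support w).toFinset)
    (by rwa [Set.coe_toFinset]) (Set.toFinset_nonempty.2 (stdSimplex_support_nonempty w))
  rw [Set.coe_toFinset] at hb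
  exact ⟨m, b, faceCoord b.toEmbedding ⟨w, hb.ge⟩, map_faceCoord b.toEmbedding _,
    fun i => Function.mem_support.1 (hb.le (Set.mem_range_self i))⟩

end OrderComplex

section Realization

variable {C D : Type u} [Category.{w} C] [Category.{w} D]

/-- The characteristic map of a simplex of the nerve. -/
noncomputable def charMap {m : ℕ} (y : ComposableArrows D m) :
    C(stdSimplex ℝ (Fin (m + 1)), SSet.toTop.obj (nerve D)) :=
  TopCat.toSSetObjEquiv _ (op ⦋m⦌) ((sSetTopAdj.unit.app (nerve D)).app (op ⦋m⦌) y)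

theorem charMap_map {m n : ℕ} (f : Fin (m + 1) →o Fin (n + 1)) (y : ComposableArrows D n)
    (t : stdSimplex ℝ (Fin (m + 1))) :
    charMap y (stdSimplex.map f t) = charMap (f.monotone.functor ⋙ y) t := by
  have h := ConcreteCategory.congr_hom
    ((sSetTopAdj.unit.app (nerve D)).naturality (SimplexCategory.mkHom f).op) y
  exact (congrArg (fun z => TopCat.toSSetObjEquiv _ (op ⦋m⦌) z t) h).symm

variable {P Q : Type} [Fintype P] [PartialOrder P] [Fintype Q] [PartialOrder Q]

/-- The map from the order complex of `P` to `|D|` induced by a diagram `P ⥤ D`: a point is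
represented on a chain of `P`, and `realize_eq` shows that the choice of the chain is immaterial. -/
noncomputable def realize (Y : P ⥤ D) (w : OrderComplex P) : SSet.toTop.obj (nerve D) :=
  charMap ((exists_map_eq_of_mem_orderComplex w.2).choose_spec.choose.monotone.functor ⋙ Y)
    (exists_map_eq_of_mem_orderComplex w.2).choose_spec.choose_spec.choose

theorem charMap_eq_of_map_eq (Y : P ⥤ D) {m n : ℕ} {a : Fin (m + 1) →o P}
    {u : stdSimplex ℝ (Fin (m + 1))} {b : Fin (n + 1) ↪o P} {v : stdSimplex ℝ (Fin (n + 1))}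
    (h : stdSimplex.map a u = stdSimplex.map b v) :
    charMap (a.monotone.functor ⋙ Y) u = charMap (b.monotone.functor ⋙ Y) v := by
  obtain ⟨l, d, u', rfl, hu⟩ :=
    exists_map_eq_of_mem_orderComplex (mem_orderComplex_of_linearOrder u)
  have hrange (i : Fin (l + 1)) : ∃ j, b j = a (d i) := by
    have hi : a (d i) ∈ Function.support (stdSimplex.map b v) := by
      rw [← h, stdSimplex.map_comp_apply, support_stdSimplex_map]
      exact ⟨i, hu i, rfl⟩
    rw [support_stdSimplex_map] at hi
    exact hi.imp fun _ => And.right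
  choose e he using hrange
  have he_mono : Monotone e := fun i j hij => by
    rw [← b.le_iff_le, he, he]
    exact a.monotone (d.monotone hij)
  have hev : stdSimplex.map e u' = v := by
    apply stdSimplex_map_injective b.injective
    rw [← h, stdSimplex.map_comp_apply, stdSimplex.map_comp_apply]
    exact congrArg (stdSimplex.map · u') (funext he)
  have hab : d.monotone.functor ⋙ a.monotone.functor =
      he_mono.functor ⋙ b.monotone.functor :=
    CategoryTheory.Functor.ext fun i => (he i).symm
  calc charMap (a.monotone.functor ⋙ Y) (stdSimplex.map d u')
      = charMap (d.monotone.functor ⋙ a.monotone.functor ⋙ Y) u' := charMap_map d.toOrderHom _ u'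
    _ = charMap (he_mono.functor ⋙ b.monotone.functor ⋙ Y) u' := by
      rw [← Functor.assoc, hab, Functor.assoc]
    _ = charMap (b.monotone.functor ⋙ Y) (stdSimplex.map e u') :=
      (charMap_map ⟨e, he_mono⟩ _ u').symm
    _ = charMap (b.monotone.functor ⋙ Y) v := by rw [hev]

theorem realize_eq (Y : P ⥤ D) {m : ℕ} (a : Fin (m + 1) →o P) (u : stdSimplex ℝ (Fin (m + 1)))
    {w : OrderComplex P} (h : stdSimplex.map a u = w) :
    realize Y w = charMap (a.monotone.functor ⋙ Y) u :=
  have hw := (exists_map_eq_of_mem_orderComplex w.2).choose_spec.choose_spec.choose_spec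
  (charMap_eq_of_map_eq Y (h.trans hw.1.symm)).symm

theorem realize_map (f : P →o Q) (Y : Q ⥤ D) (w : OrderComplex P) :
    realize Y ⟨stdSimplex.map f w.1, map_mem_orderComplex f w.2⟩ =
      realize (f.monotone.functor ⋙ Y) w := by
  obtain ⟨m, b, v, hv, -⟩ := exists_map_eq_of_mem_orderComplex w.2
  rw [realize_eq _ b.toOrderHom v hv]
  refine realize_eq Y (f.comp b.toOrderHom) v ?_
  rw [Subtype.coe_mk, ← hv, stdSimplex.map_comp_apply]
  rfl

theorem continuous_realize (Y : P ⥤ D) : Continuous (realize Y) := by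
  let chains := {s : Finset P // IsChain (· ≤ ·) (s : Set P) ∧ s.Nonempty}
  let piece (s : chains) : Set (OrderComplex P) := {w | Function.support w.1 ⊆ s.1}
  refine (locallyFinite_of_finite piece).continuous (Set.eq_univ_of_forall fun w => ?_)
    (fun s => ?_) fun s => ?_
  · classical
    exact Set.mem_iUnion.2 ⟨⟨(Function.support w.1).toFinset, by rw [Set.coe_toFinset]; exact w.2,
      Set.toFinset_nonempty.2 (stdSimplex_support_nonempty w.1)⟩, (Set.coe_toFinset _).ge⟩
  · have : piece s = ⋂ x ∉ s.1, {w | w.1 x = 0} := by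
      ext w
      rw [Set.mem_iInter₂]
      exact Function.support_subset_iff'
    rw [this]
    exact isClosed_biInter fun x _ => isClosed_eq ((continuous_apply x).comp
      (continuous_subtype_val.comp continuous_subtype_val)) continuous_const
  · obtain ⟨m, b, hb⟩ := exists_orderEmbedding_range_eq s.2.1 s.2.2
    rw [continuousOn_iff_continuous_domRestrict]
    have h (w : piece s) : Function.support w.1.1 ⊆ Set.range b.toEmbedding := w.2.trans hb.ge
    refine ((charMap (b.monotone.functor ⋙ Y)).continuous.comp
      ((continuous_faceCoord b.toEmbedding).comp (Continuous.subtype_mk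
        (continuous_subtype_val.comp continuous_subtype_val) h))).congr fun w => ?_
    exact (realize_eq Y b.toOrderHom _ (map_faceCoord b.toEmbedding ⟨w.1.1, h w⟩)).symm

end Realization

section Prism

variable {ι κ : Type*} [Fintype ι] [LinearOrder ι] [Fintype κ] [LinearOrder κ]

/-- The mass at `i` of the initial part of total mass `min 1 s` of the mass distribution `t`. -/
def initialMass (t : ι → ℝ) (s : ℝ) (i : ι) : ℝ :=
  min (∑ j with j ≤ i, t j) s - min (∑ j with j < i, t j) s

theorem sum_le_eq_sum_lt_add (t : ι → ℝ) (i : ι) :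
    ∑ j with j ≤ i, t j = ∑ j with j < i, t j + t i := by
  rw [← Finset.sum_filter_add_sum_filter_not _ (· < i), Finset.filter_filter]
  congr 1
  · exact congrArg (Finset.sum · t) (Finset.filter_congr fun j _ => by simpa using le_of_lt)
  · rw [Finset.filter_filter]
    exact (congrArg (Finset.sum · t) (by ext; simp [le_antisymm_iff])).trans
      (Finset.sum_singleton t i)

theorem initialMass_of_le {t : ι → ℝ} {s : ℝ} {i : ι} (h : s ≤ ∑ j with j < i, t j)
    (hi : 0 ≤ t i) : initialMass t s i = 0 := by
  rw [initialMass, sum_le_eq_sum_lt_add, min_eq_right h,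
    min_eq_right (h.trans (le_add_of_nonneg_right hi)), sub_self]

theorem initialMass_of_ge {t : ι → ℝ} {s : ℝ} {i : ι} (h : ∑ j with j ≤ i, t j ≤ s)
    (hi : 0 ≤ t i) : initialMass t s i = t i := by
  rw [sum_le_eq_sum_lt_add] at h
  rw [initialMass, sum_le_eq_sum_lt_add, min_eq_left h,
    min_eq_left ((le_add_of_nonneg_right hi).trans h), add_sub_cancel_left]

theorem initialMass_nonneg {t : ι → ℝ} {s : ℝ} {i : ι} (hi : 0 ≤ t i) :
    0 ≤ initialMass t s i := by
  rw [initialMass, sum_le_eq_sum_lt_add, sub_nonneg]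
  exact min_le_min_right _ (le_add_of_nonneg_right hi)

theorem initialMass_le {t : ι → ℝ} {s : ℝ} {i : ι} (hi : 0 ≤ t i) : initialMass t s i ≤ t i := by
  rcases le_total s (∑ j with j < i, t j) with h | h
  · exact (initialMass_of_le h hi).trans_le hi
  · rw [initialMass, sum_le_eq_sum_lt_add, min_eq_left h, sub_le_iff_le_add']
    exact min_le_left _ _

theorem sum_initialMass (t : ι → ℝ) {s : ℝ} (hs : 0 ≤ s) {A : Finset ι}
    (hA : IsLowerSet (A : Set ι)) : ∑ i ∈ A, initialMass t s i = min (∑ i ∈ A, t i) s := by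
  induction A using Finset.induction_on_max with
  | empty => simp [hs]
  | insert a A ha ih =>
    have haA : a ∉ A := fun h => (ha a h).false
    have hlt : Finset.univ.filter (· < a) = A := by
      ext j
      have := @hA a j
      grind
    have hA' : IsLowerSet (A : Set ι) := by
      rw [← hlt, Finset.coe_filter_univ]
      exact isLowerSet_Iio a
    rw [Finset.sum_insert haA, ih hA', initialMass, sum_le_eq_sum_lt_add, hlt,
      Finset.sum_insert haA, sub_add_cancel, add_comm]

theorem initialMass_map (f : ι →o κ) (t : stdSimplex ℝ ι) {s : ℝ} (hs : 0 ≤ s) (j : κ) :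
    initialMass (stdSimplex.map f t) s j = ∑ i with f i = j, initialMass t s i := by
  have hle : IsLowerSet ((Finset.univ.filter (f · ≤ j) : Finset ι) : Set ι) := by
    rw [Finset.coe_filter_univ]
    exact (isLowerSet_Iic j).preimage f.monotone
  have hlt : IsLowerSet ((Finset.univ.filter (f · < j) : Finset ι) : Set ι) := by
    rw [Finset.coe_filter_univ]
    exact (isLowerSet_Iio j).preimage f.monotone
  have hsub : Finset.univ.filter (f · < j) ⊆ Finset.univ.filter (f · ≤ j) :=
    Finset.monotone_filter_right _ fun _ _ => le_of_lt
  have hsdiff : Finset.univ.filter (f · ≤ j) \ Finset.univ.filter (f · < j) =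
      Finset.univ.filter (f · = j) := by
    ext i
    simp [le_antisymm_iff]
  rw [initialMass, sum_stdSimplex_map, sum_stdSimplex_map, ← hsdiff, Finset.sum_sdiff_eq_sub hsub,
    sum_initialMass t hs hle, sum_initialMass t hs hlt]
  simp only [Finset.mem_filter_univ]

/-- The point of the prism `Δ × [0, 1]` over `(t, s)`, in the triangulation of the prism as the
order complex of `[1] × ι`. -/
def prismPoint (t : stdSimplex ℝ ι) (s : unitInterval) : stdSimplex ℝ (Fin 2 × ι) :=
  ⟨fun p => ![initialMass t s p.2, t p.2 - initialMass t s p.2] p.1,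
    fun ⟨k, i⟩ => by
      fin_cases k
      · exact initialMass_nonneg (stdSimplex.zero_le t i)
      · exact sub_nonneg.2 (initialMass_le (stdSimplex.zero_le t i)),
    by simp [Fintype.sum_prod_type]⟩

theorem prismPoint_fst_zero (t : stdSimplex ℝ ι) (s : unitInterval) (i : ι) :
    prismPoint t s (0, i) = initialMass t s i := rfl

theorem prismPoint_fst_one (t : stdSimplex ℝ ι) (s : unitInterval) (i : ι) :
    prismPoint t s (1, i) = t i - initialMass t s i := rfl

theorem prismPoint_mem_orderComplex (t : stdSimplex ℝ ι) (s : unitInterval) :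
    prismPoint t s ∈ OrderComplex (Fin 2 × ι) := by
  have le_of_ne_zero {i j : ι} (hj : prismPoint t s (0, j) ≠ 0) (hi : prismPoint t s (1, i) ≠ 0) :
      j ≤ i := by
    by_contra! hij
    have hj' : ∑ l with l < j, t l < s :=
      not_le.1 fun h => hj (initialMass_of_le h (stdSimplex.zero_le t j))
    have hi' : s < ∑ l with l ≤ i, t l :=
      not_le.1 fun h => hi (sub_eq_zero.2 (initialMass_of_ge h (stdSimplex.zero_le t i)).symm)
    refine (hi'.trans_le ?_).not_gt hj'
    exact Finset.sum_le_sum_of_subset_of_nonneg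
      (Finset.monotone_filter_right _ fun l _ hl => hl.trans_lt hij)
      fun l _ _ => stdSimplex.zero_le t l
  rintro ⟨a, i⟩ hi ⟨b, j⟩ hj -
  fin_cases a <;> fin_cases b
  · simpa using le_total i j
  · exact .inl ⟨zero_le_one, le_of_ne_zero hi hj⟩
  · exact .inr ⟨zero_le_one, le_of_ne_zero hj hi⟩
  · simpa using le_total i j

theorem continuous_prismPoint :
    Continuous fun q : stdSimplex ℝ ι × unitInterval => prismPoint q.1 q.2 := by
  have ht (i : ι) : Continuous fun q : stdSimplex ℝ ι × unitInterval => q.1 i :=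
    (continuous_apply i).comp (continuous_subtype_val.comp continuous_fst)
  have hm (i : ι) :
      Continuous fun q : stdSimplex ℝ ι × unitInterval => initialMass q.1 q.2 i := by
    unfold initialMass
    fun_prop
  refine Continuous.subtype_mk (continuous_pi fun ⟨k, i⟩ => ?_) fun q => (prismPoint q.1 q.2).2
  fin_cases k
  · exact hm i
  · exact (ht i).sub (hm i)

theorem prismPoint_map (f : ι →o κ) (t : stdSimplex ℝ ι) (s : unitInterval) :
    prismPoint (stdSimplex.map f t) s = stdSimplex.map (Prod.map id f) (prismPoint t s) := by
  ext ⟨k, j⟩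
  have h : Finset.univ.filter (Prod.map id f · = (k, j)) =
      {k} ×ˢ Finset.univ.filter (f · = j) := by
    ext
    simp only [Finset.mem_filter_univ, Finset.mem_product, Finset.mem_singleton, Prod.ext_iff,
      Prod.map_fst, Prod.map_snd, id]
  rw [stdSimplex_map_apply, h, Finset.sum_product, Finset.sum_singleton]
  fin_cases k
  · exact initialMass_map f t s.2.1 j
  · refine (congrArg₂ (· - ·) (stdSimplex_map_apply f t j) (initialMass_map f t s.2.1 j)).trans ?_
    exact (Finset.sum_sub_distrib _ _).symm

theorem prismPoint_zero (t : stdSimplex ℝ ι) :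
    prismPoint t 0 = stdSimplex.map (Prod.mk 1) t := by
  have h (i : ι) : initialMass t 0 i = 0 :=
    initialMass_of_le (Finset.sum_nonneg fun j _ => stdSimplex.zero_le t j) (stdSimplex.zero_le t i)
  ext ⟨k, i⟩
  rw [stdSimplex_map_apply]
  fin_cases k
  · simpa [prismPoint_fst_zero] using h i
  · simp [prismPoint_fst_one, h, Finset.filter_eq']

theorem prismPoint_one (t : stdSimplex ℝ ι) :
    prismPoint t 1 = stdSimplex.map (Prod.mk 0) t := by
  have h (i : ι) : initialMass t 1 i = t i :=
    initialMass_of_ge ((Finset.sum_le_univ_sum_of_nonneg (stdSimplex.zero_le t)).trans_eq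
      (stdSimplex.sum_eq_one t)) (stdSimplex.zero_le t i)
  ext ⟨k, i⟩
  rw [stdSimplex_map_apply]
  fin_cases k
  · simp [prismPoint_fst_zero, h, Finset.filter_eq']
  · simpa [prismPoint_fst_one] using (sub_eq_zero.2 (h i).symm)

end Prism

/-- The map from the prism over the simplex on `ι` to the order complex of `[1] × ι` that inverts
the triangulation of the prism. -/
def prismMap (ι : Type*) [Fintype ι] [LinearOrder ι] :
    C(stdSimplex ℝ ι × unitInterval, OrderComplex (Fin 2 × ι)) :=
  ⟨fun q => ⟨prismPoint q.1 q.2, prismPoint_mem_orderComplex q.1 q.2⟩,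
    continuous_prismPoint.subtype_mk _⟩

section NaturalTransformation

variable {C D : Type u} [Category.{w} C] [Category.{w} D] {G H : C ⥤ D} (α : G ⟶ H)

/-- The diagram `p ↦ α_{a p} (x (b p))` in `D`, for an `n`-simplex `x` of the nerve of `C`. With
the two projections of `[1] × [n]` it is the prism over `x`. -/
def prismDiagram {P : Type} [PartialOrder P] {n : ℕ} (a : P →o Fin 2) (b : P →o Fin (n + 1))
    (x : ComposableArrows C n) : P ⥤ D :=
  Functor.prod' a.monotone.functor (b.monotone.functor ⋙ x) ⋙
    Functor.uncurry.obj (ComposableArrows.mk₁ α)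

theorem functor_comp_prismDiagram {P Q : Type} [PartialOrder P] [PartialOrder Q] {n : ℕ}
    (f : Q →o P) (a : P →o Fin 2) (b : P →o Fin (n + 1)) (x : ComposableArrows C n) :
    f.monotone.functor ⋙ prismDiagram α a b x = prismDiagram α (a.comp f) (b.comp f) x := rfl

theorem prismDiagram_comp {P : Type} [PartialOrder P] {m n : ℕ} (a : P →o Fin 2)
    (b : P →o Fin (m + 1)) (f : Fin (m + 1) →o Fin (n + 1)) (x : ComposableArrows C n) :
    prismDiagram α a b (f.monotone.functor ⋙ x) = prismDiagram α a (f.comp b) x := rfl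

theorem prismDiagram_zero {n : ℕ} (x : ComposableArrows C n) :
    prismDiagram α (OrderHom.const _ 0) OrderHom.id x = x ⋙ G := by
  refine CategoryTheory.Functor.ext (fun i => rfl) fun i j f => ?_
  change ((ComposableArrows.mk₁ α).map (𝟙 0)).app _ ≫ G.map _ = _
  rw [CategoryTheory.Functor.map_id, NatTrans.id_app]
  exact (Category.id_comp _).trans ((Category.id_comp _).trans (Category.comp_id _)).symm

theorem prismDiagram_one {n : ℕ} (x : ComposableArrows C n) :
    prismDiagram α (OrderHom.const _ 1) OrderHom.id x = x ⋙ H := by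
  refine CategoryTheory.Functor.ext (fun i => rfl) fun i j f => ?_
  change ((ComposableArrows.mk₁ α).map (𝟙 1)).app _ ≫ H.map _ = _
  rw [CategoryTheory.Functor.map_id, NatTrans.id_app]
  exact (Category.id_comp _).trans ((Category.id_comp _).trans (Category.comp_id _)).symm

/-- The homotopy on the simplex `x` of the nerve, as a map to the space of paths. -/
noncomputable def simplexHomotopy {n : ℕ} (x : ComposableArrows C n) :
    C(stdSimplex ℝ (Fin (n + 1)), C(unitInterval, SSet.toTop.obj (nerve D))) :=
  ContinuousMap.curry
    (ContinuousMap.comp ⟨_, continuous_realize (prismDiagram α OrderHom.fst OrderHom.snd x)⟩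
      (prismMap (Fin (n + 1))))

theorem simplexHomotopy_apply {n : ℕ} (x : ComposableArrows C n)
    (t : stdSimplex ℝ (Fin (n + 1))) (s : unitInterval) :
    simplexHomotopy α x t s = realize (prismDiagram α OrderHom.fst OrderHom.snd x)
      ⟨prismPoint t s, prismPoint_mem_orderComplex t s⟩ := rfl

theorem simplexHomotopy_map {m n : ℕ} (f : Fin (m + 1) →o Fin (n + 1))
    (x : ComposableArrows C n) (t : stdSimplex ℝ (Fin (m + 1))) :
    simplexHomotopy α x (stdSimplex.map f t) =
      simplexHomotopy α (f.monotone.functor ⋙ x) t := by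
  ext s
  have h := realize_map (OrderHom.id.prodMap f) (prismDiagram α OrderHom.fst OrderHom.snd x)
    ⟨prismPoint t s, prismPoint_mem_orderComplex t s⟩
  rw [functor_comp_prismDiagram] at h
  rw [simplexHomotopy_apply, simplexHomotopy_apply, prismDiagram_comp]
  exact (congrArg _ (Subtype.ext (prismPoint_map f t s))).trans h

theorem simplexHomotopy_eq_charMap {n : ℕ} (x : ComposableArrows C n)
    {t : stdSimplex ℝ (Fin (n + 1))} {s : unitInterval} {k : Fin 2}
    (h : prismPoint t s = stdSimplex.map (Prod.mk k) t) :
    simplexHomotopy α x t s =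
      charMap (prismDiagram α (OrderHom.const _ k) OrderHom.id x) t := by
  have hk : stdSimplex.map ((OrderHom.const (Fin (n + 1)) k).prod OrderHom.id) t =
      prismPoint t s := h.symm
  rw [simplexHomotopy_apply, realize_eq _ _ t hk, functor_comp_prismDiagram,
    OrderHom.fst_comp_prod, OrderHom.snd_comp_prod]

/-- The simplicial map adjoint to the homotopy `|C| → C(I, |D|)`. -/
noncomputable def nerveToPaths : nerve C ⟶
    TopCat.toSSet.obj (TopCat.of C(unitInterval, SSet.toTop.obj (nerve D))) where
  app Δ := ↾fun x => (TopCat.toSSetObjEquiv _ Δ).symm (simplexHomotopy α x)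
  naturality Δ Δ' f := by
    ext x
    apply (TopCat.toSSetObjEquiv _ Δ').injective
    exact ContinuousMap.ext fun t => (simplexHomotopy_map α f.unop.toOrderHom x t).symm

/-- Evaluation of paths. -/
def pathEval (Y : TopCat.{u}) (s : unitInterval) : TopCat.of C(unitInterval, Y) ⟶ Y :=
  TopCat.ofHom ⟨fun γ => γ s, continuous_eval_const s⟩

theorem transpose_nerveToPaths_eval (s : unitInterval) (K : C ⥤ D)
    (h : ∀ {n : ℕ} (x : ComposableArrows C n) (t : stdSimplex ℝ (Fin (n + 1))),
      simplexHomotopy α x t s = charMap (x ⋙ K) t) :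
    (sSetTopAdj.homEquiv _ _).symm (nerveToPaths α) ≫ pathEval _ s =
      SSet.toTop.map (nerveMap K) := by
  have hK : nerveToPaths α ≫ TopCat.toSSet.map (pathEval _ s) =
      nerveMap K ≫ sSetTopAdj.unit.app (nerve D) := by
    ext Δ x
    apply (TopCat.toSSetObjEquiv _ Δ).injective
    exact ContinuousMap.ext fun t => h x t
  rw [← Adjunction.homEquiv_naturality_right_symm, hK, Equiv.symm_apply_eq,
    Adjunction.homEquiv_unit, Adjunction.unit_naturality]

include α in
theorem homotopic_nerveRealization : (nerveRealization G).Homotopic (nerveRealization H) := by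
  let Φ := (sSetTopAdj.homEquiv _ _).symm (nerveToPaths α)
  have hH : Φ ≫ pathEval _ 0 = SSet.toTop.map (nerveMap H) :=
    transpose_nerveToPaths_eval α 0 H fun x t => by
      rw [simplexHomotopy_eq_charMap α x (prismPoint_zero t), prismDiagram_one]
  have hG : Φ ≫ pathEval _ 1 = SSet.toTop.map (nerveMap G) :=
    transpose_nerveToPaths_eval α 1 G fun x t => by
      rw [simplexHomotopy_eq_charMap α x (prismPoint_one t), prismDiagram_zero]
  exact ContinuousMap.Homotopic.symm ⟨⟨⟨fun q => Φ q.2 q.1,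
      (ContinuousMap.continuous_uncurry_of_continuous Φ.hom).comp continuous_swap⟩,
    ConcreteCategory.congr_hom hH, ConcreteCategory.congr_hom hG⟩⟩

end NaturalTransformation

section HomotopyEquivalence

variable {C D : Type u} [Category.{w} C] [Category.{w} D]

theorem nerveRealization_comp {E : Type u} [Category.{w} E] (G : C ⥤ D) (H : D ⥤ E) :
    (nerveRealization H).comp (nerveRealization G) = nerveRealization (G ⋙ H) :=
  congrArg TopCat.Hom.hom (SSet.toTop.map_comp (nerveMap G) (nerveMap H)).symm

theorem nerveRealization_id : nerveRealization (𝟭 C) = ContinuousMap.id _ :=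
  congrArg TopCat.Hom.hom (SSet.toTop.map_id (nerve C))

theorem isNerveEquivWithInverse_of_natTrans_of_comp_eq {G : C ⥤ D} {H : D ⥤ C}
    (α : G ⋙ H ⟶ 𝟭 C) (h : H ⋙ G = 𝟭 D) : IsNerveEquivWithInverse G H := by
  constructor
  · rw [nerveRealization_comp, ← nerveRealization_id]
    exact homotopic_nerveRealization α
  · rw [nerveRealization_comp, h, nerveRealization_id]

end HomotopyEquivalence

end NerveRealization

section NormalizerCondition

open Subgroup
open scoped IsMulCommutative

theorem finite_of_fg_of_isMulTorsion {G : Type*} [Group G] [Group.FG G] (hG : IsMulTorsion G)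
    (A : Subgroup G) [IsMulCommutative A] [A.FiniteIndex] : Finite G := by
  have : Finite A := CommGroup.finite_of_fg_isMulTorsion A (hG.subgroup A)
  have : Finite (G ⧸ A) := finite_quotient_of_finiteIndex
  exact Finite.of_equiv _ (groupEquivQuotientProdSubgroup (s := A)).symm

theorem eq_of_normalizer_inf_le {G : Type*} [Group G] {H K : Subgroup G}
    (hK : NormalizerCondition K) (hHK : H ≤ K) (h : normalizer (H : Set G) ⊓ K ≤ H) : H = K := by
  refine le_antisymm hHK (subgroupOf_eq_top.1 ?_)
  refine normalizerCondition_iff_only_full_group_self_normalizing.1 hK _ ?_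
  rw [← subgroupOf_normalizer_eq hHK]
  exact le_antisymm (fun x hx => h ⟨hx, x.2⟩) fun x hx => le_normalizer hx

theorem exists_finite_le_sup_closure {G : Type*} [Group G] {N H : Subgroup G}
    [N.IsFiniteRelIndex H] : ∃ X : Set G, X.Finite ∧ X ⊆ H ∧ H ≤ N ⊔ closure X := by
  have : Finite (H ⧸ N.subgroupOf H) := finite_quotient_of_finiteIndex
  refine ⟨Set.range fun c : H ⧸ N.subgroupOf H => (c.out : G), Set.finite_range _,
    Set.range_subset_iff.2 fun c => c.out.2, fun h hh => ?_⟩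
  obtain ⟨n, hn⟩ := QuotientGroup.mk_out_eq_mul (N.subgroupOf H) ⟨h, hh⟩
  have hc : ((QuotientGroup.mk (s := N.subgroupOf H) ⟨h, hh⟩).out : G) = h * n.1 :=
    congrArg Subtype.val hn
  rw [eq_mul_inv_of_mul_eq hc.symm]
  exact mul_mem (mem_sup_right (subset_closure ⟨_, rfl⟩)) (mem_sup_left (inv_mem n.2))

variable {p : ℕ} [Fact p.Prime] {G : Type*} [Group G]

theorem finite_closure_of_isPGroup (hG : IsPGroup p G) (A : Subgroup G) [IsMulCommutative A]
    [A.FiniteIndex] {X : Set G} (hX : X.Finite) : Finite (closure X) := by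
  have := hX.to_subtype
  exact finite_of_fg_of_isMulTorsion
    (fun g => (hG.to_subgroup _).isOfFinOrder (Fact.out (p := p.Prime)).ne_zero g)
    (A.subgroupOf (closure X))

theorem normalizer_le_of_normalizer_eq_self (hG : IsPGroup p G) (A : Subgroup G)
    [IsMulCommutative A] [A.FiniteIndex] {N H : Subgroup G} (hNH : N ≤ H)
    [N.IsFiniteRelIndex H] (hHN : H ≤ normalizer (N : Set G))
    (hH : normalizer (H : Set G) = H) : normalizer (N : Set G) ≤ H := by
  intro g hg
  obtain ⟨X, hX, hXH, hHX⟩ := exists_finite_le_sup_closure (N := N) (H := H)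
  -- `K` is a finite `p`-group, so `H ⊓ K` would have to grow in `K` were it not all of `K`.
  let K := closure (insert g X)
  have hKN : K ≤ normalizer (N : Set G) :=
    (closure_le _).2 (Set.insert_subset hg (hXH.trans hHN))
  have hNK : N ⊔ H ⊓ K = H := le_antisymm (sup_le hNH inf_le_left) (hHX.trans
    (sup_le_sup_left (le_inf ((closure_le H).2 hXH) (closure_mono (Set.subset_insert g X))) N))
  have : Finite K := finite_closure_of_isPGroup hG A (hX.insert g)
  have : Group.IsNilpotent K := (hG.to_subgroup K).isNilpotent
  have hHK : H ⊓ K = K := by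
    refine eq_of_normalizer_inf_le Group.normalizerCondition_of_isNilpotent inf_le_right
      fun k ⟨hkH, hkK⟩ => ⟨hH.le ?_, hkK⟩
    rw [← hNK]
    exact normalizer_inf_normalizer_le_normalizer_sup N (H ⊓ K) ⟨hKN hkK, hkH⟩
  exact (hHK.ge (subset_closure (Set.mem_insert g X))).1

theorem normalizerCondition_of_isPGroup (hG : IsPGroup p G) (A : Subgroup G) [A.Normal]
    [IsMulCommutative A] [A.FiniteIndex] : NormalizerCondition G := by
  refine normalizerCondition_iff_only_full_group_self_normalizing.2 fun H hH => ?_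
  have : A.IsFiniteRelIndex H := isFiniteRelIndex_of_finiteIndex
  have : (A ⊓ H).IsFiniteRelIndex H := ⟨by
    rw [inf_relIndex_right]
    exact relIndex_ne_zero⟩
  have hAH : A ≤ H :=
    calc A ≤ centralizer (A : Set G) := le_centralizer A
      _ ≤ centralizer ((A ⊓ H : Subgroup G) : Set G) := centralizer_le inf_le_left
      _ ≤ normalizer ((A ⊓ H : Subgroup G) : Set G) := centralizer_le_normalizer _
      _ ≤ H := normalizer_le_of_normalizer_eq_self hG A inf_le_right
        ((le_inf le_normalizer_of_normal le_normalizer).trans inf_normalizer_le_normalizer_inf) hH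
  refine top_le_iff.1 ?_
  rw [← normalizer_eq_top A]
  exact normalizer_le_of_normalizer_eq_self hG A hAH le_normalizer_of_normal hH

end NormalizerCondition

section DiscretePToral

variable {p : ℕ} [Fact p.Prime] {S : Type u} [Group S]

theorem isPGroup_pi_pruferGroup (k : ℕ) :
    IsPGroup p (Multiplicative (Fin k → PruferGroup p)) := by
  refine isPGroup_iff_pow_pow_eq_one.2 fun g => ?_
  have h (i : Fin k) : ∃ n : ℕ, p ^ n • g.toAdd i = 0 :=
    (g.toAdd i).2.imp fun n hn => Subtype.ext hn
  choose n hn using h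
  refine ⟨∑ i, n i, Multiplicative.toAdd.injective (funext fun i => ?_)⟩
  obtain ⟨c, hc⟩ := pow_dvd_pow p (Finset.single_le_sum_of_canonicallyOrdered (f := n)
    (Finset.mem_univ i))
  rw [toAdd_pow, Pi.smul_apply, hc, mul_comm, mul_smul, hn, smul_zero]
  rfl

namespace IsDiscretePToral

theorem isPGroup (h : IsDiscretePToral p S) : IsPGroup p S := by
  obtain ⟨k, c, T, hT, ⟨e⟩, -, hp, -⟩ := h
  have hT : IsPGroup p T := (isPGroup_pi_pruferGroup k).of_equiv e.symm
  have hS := (hp.to_subgroup ⊤).comap_of_ker_isPGroup (QuotientGroup.mk' T)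
    (by rwa [QuotientGroup.ker_mk'])
  exact hS.of_equiv Subgroup.topEquiv

theorem normalizerCondition (h : IsDiscretePToral p S) (Q : Subgroup S) :
    NormalizerCondition Q := by
  have hQ : IsPGroup p Q := h.isPGroup.to_subgroup Q
  obtain ⟨k, c, T, hT, ⟨e⟩, hfin, -, -⟩ := h
  have : IsMulCommutative T := ⟨⟨fun x y => e.injective (by rw [map_mul, map_mul, mul_comm])⟩⟩
  have : T.FiniteIndex := Subgroup.finiteIndex_of_finite_quotient
  exact normalizerCondition_of_isPGroup hQ (T.subgroupOf Q)

theorem eq_of_normalizer_inf_le (h : IsDiscretePToral p S) {P Q : Subgroup S} (hPQ : P ≤ Q)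
    (hn : normS P ⊓ Q ≤ P) : P = Q :=
  _root_.eq_of_normalizer_inf_le (h.normalizerCondition Q) hPQ hn

end IsDiscretePToral

end DiscretePToral

section Images

variable {S : Type u} [Group S]

theorem imageOf_comp {P Q R : Subgroup S} (φ : P →* Q) (ψ : Q →* R) :
    imageOf (ψ.comp φ) = imageOn ψ (imageOf φ) := by
  ext y
  constructor
  · rintro ⟨x, rfl⟩
    exact ⟨φ x, ⟨x, rfl⟩, rfl⟩
  · rintro ⟨z, ⟨x, hx⟩, rfl⟩
    exact ⟨x, congrArg (fun z => ((ψ z : R) : S)) (Subtype.ext hx)⟩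

theorem imageOf_inclusion {P Q : Subgroup S} (h : P ≤ Q) : imageOf (Subgroup.inclusion h) = P := by
  ext y
  exact ⟨by rintro ⟨x, rfl⟩; exact x.2, fun hy => ⟨⟨y, hy⟩, rfl⟩⟩

theorem imageOf_inclusion_comp_mulEquiv {P Q R : Subgroup S} (h : Q ≤ R) (e : P ≃* Q) :
    imageOf ((Subgroup.inclusion h).comp e.toMonoidHom) = Q := by
  ext y
  exact ⟨by rintro ⟨x, rfl⟩; exact (e x).2, fun hy => ⟨e.symm ⟨y, hy⟩, by simp⟩⟩

theorem imageOf_comp_inclusion {P Q A : Subgroup S} (φ : P →* Q) (hA : A ≤ P) :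
    imageOf (φ.comp (Subgroup.inclusion hA)) = imageOn φ A := by
  rw [imageOf_comp, imageOf_inclusion]

theorem imageOn_self {P Q : Subgroup S} (φ : P →* Q) : imageOn φ P = imageOf φ :=
  (imageOf_comp_inclusion φ le_rfl).symm

theorem imageOf_le {P Q : Subgroup S} (φ : P →* Q) : imageOf φ ≤ Q := by
  rintro _ ⟨x, rfl⟩
  exact (φ x).2

theorem imageOn_le {P Q : Subgroup S} (φ : P →* Q) (A : Subgroup S) : imageOn φ A ≤ Q := by
  rintro _ ⟨x, -, rfl⟩
  exact (φ x).2

theorem imageOn_mono {P Q A B : Subgroup S} (φ : P →* Q) (h : A ≤ B) :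
    imageOn φ A ≤ imageOn φ B := by
  rintro _ ⟨x, hx, rfl⟩
  exact ⟨x, h hx, rfl⟩

theorem imageOn_inclusion {P Q A : Subgroup S} (h : P ≤ Q) (hA : A ≤ P) :
    imageOn (Subgroup.inclusion h) A = A := by
  rw [← imageOf_comp_inclusion _ hA]
  exact imageOf_inclusion (hA.trans h)

theorem le_of_imageOn_le {P Q A B : Subgroup S} {φ : P →* Q} (hφ : Function.Injective φ)
    (hA : A ≤ P) (h : imageOn φ A ≤ imageOn φ B) : A ≤ B := by
  intro x hx
  obtain ⟨y, hy, hxy⟩ := h ⟨⟨x, hA hx⟩, hx, rfl⟩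
  obtain rfl : y = ⟨x, hA hx⟩ := hφ (Subtype.ext hxy)
  exact hy

theorem imageOn_normS {P Q : Subgroup S} (φ : P →* Q) (A : Subgroup S) :
    imageOn φ (normS A) ≤ normS (imageOn φ A) := by
  have conj_mem {x : P} (hx : (x : S) ∈ normS A) {y : S} (hy : y ∈ imageOn φ A) :
      (φ x : S) * y * (φ x : S)⁻¹ ∈ imageOn φ A := by
    obtain ⟨z, hz, rfl⟩ := hy
    exact ⟨x * z * x⁻¹, (Subgroup.mem_normalizer_iff.1 hx z).1 hz, by simp⟩
  rintro _ ⟨x, hx, rfl⟩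
  refine Subgroup.mem_normalizer_iff.2 fun y => ⟨conj_mem hx, fun hy => ?_⟩
  have := conj_mem (x := x⁻¹) (inv_mem hx) hy
  simpa [mul_assoc] using this

theorem innAut_le_autS (P : Subgroup S) : innAut P ≤ autS P := by
  rintro _ ⟨x, rfl⟩
  exact ⟨x, le_normS P x.2, fun _ => rfl⟩

theorem range_normalizerMonoidHom (P : Subgroup S) : P.normalizerMonoidHom.range = autS P := by
  ext α
  constructor
  · rintro ⟨g, rfl⟩
    exact ⟨g, g.2, fun _ => rfl⟩
  · rintro ⟨g, hg, hα⟩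
    exact ⟨⟨g, hg⟩, MulEquiv.ext fun x => Subtype.ext (hα x).symm⟩

theorem isPGroup_autS {p : ℕ} (hS : IsPGroup p S) (P : Subgroup S) : IsPGroup p (autS P) := by
  rw [← range_normalizerMonoidHom]
  exact (hS.to_subgroup (normS P)).of_surjective _ P.normalizerMonoidHom.rangeRestrict_surjective

theorem normS_le_extDomain {P Q R : Subgroup S} (hQR : Q ≤ R) {e : P ≃* Q}
    (he : ∀ α ∈ autS P, MulAut.congr e α ∈ autS Q) :
    normS P ≤ extDomain ((Subgroup.inclusion hQR).comp e.toMonoidHom) := by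
  intro g hg
  obtain ⟨h, hh, hconj⟩ := he (P.normalizerMonoidHom ⟨g, hg⟩) ⟨g, hg, fun _ => rfl⟩
  refine ⟨hg, h, by rwa [imageOf_inclusion_comp_mulEquiv], fun x => (Eq.trans ?_ (hconj (e x)))⟩
  simp only [MulAut.congr_apply, MulEquiv.trans_apply, MulEquiv.symm_apply_apply]
  rfl

end Images

namespace FusionSystem

variable {p : ℕ} [Fact p.Prime] {S : Type u} [Group S] {F : FusionSystem S}

theorem exists_lift {P Q R : Subgroup S} {φ : P →* R} {ψ : Q →* R} (hφ : φ ∈ F.Hom P R)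
    (hψ : ψ ∈ F.Hom Q R) (h : imageOf φ ≤ imageOf ψ) : ∃ χ ∈ F.Hom P Q, ψ.comp χ = φ := by
  obtain ⟨A, hA, e, he, -, rfl⟩ := F.factor hφ
  obtain ⟨B, hB, f, -, hf, rfl⟩ := F.factor hψ
  have hAB : A ≤ B := by
    rwa [imageOf_inclusion_comp_mulEquiv, imageOf_inclusion_comp_mulEquiv] at h
  refine ⟨f.symm.toMonoidHom.comp ((Subgroup.inclusion hAB).comp e.toMonoidHom),
    F.comp_mem (F.comp_mem he (F.inclusion_mem hAB)) hf, ?_⟩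
  ext x
  simp

theorem IsConj.symm {P Q : Subgroup S} (h : F.IsConj P Q) : F.IsConj Q P := by
  obtain ⟨e, he, he'⟩ := h
  exact ⟨e.symm, he', he⟩

variable (F) in
theorem autS_le_aut (P : Subgroup S) : autS P ≤ F.aut P := by
  have mem_hom {α : MulAut P} (hα : α ∈ autS P) : α.toMonoidHom ∈ F.Hom P P := by
    obtain ⟨g, hg, hgα⟩ := hα
    convert F.conj_mem g (fun x hx => (Subgroup.mem_normalizer_iff.1 hg x).1 hx) using 1
    ext x
    exact hgα x
  exact fun α hα => ⟨mem_hom hα, mem_hom (inv_mem hα)⟩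

theorem congr_mem_aut {P Q : Subgroup S} {e : P ≃* Q} (he : e.toMonoidHom ∈ F.Hom P Q)
    (he' : e.symm.toMonoidHom ∈ F.Hom Q P) {α : MulAut P} (hα : α ∈ F.aut P) :
    MulAut.congr e α ∈ F.aut Q :=
  ⟨F.comp_mem (F.comp_mem he' hα.1) he, F.comp_mem (F.comp_mem he' hα.2) he⟩

theorem mem_autS_of_mk_mem_outS {P : Subgroup S} {b : F.aut P}
    (hb : QuotientGroup.mk' ((innAut P).subgroupOf (F.aut P)) b ∈ F.outS P) :
    (b : MulAut P) ∈ autS P := by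
  obtain ⟨c, hc, hcb⟩ := hb
  have hinn : c⁻¹ * b ∈ (innAut P).subgroupOf (F.aut P) := QuotientGroup.eq.1 hcb
  exact (Subgroup.mul_mem_cancel_left _ (inv_mem hc)).1 (innAut_le_autS P hinn)

theorem IsSaturated.exists_conj_mem_autS (hF : F.IsSaturated p) {P : Subgroup S}
    (hP : F.IsFullyNormalized p P) {K : Subgroup (F.aut P)} (hK : IsPGroup p K) :
    ∃ a : F.aut P, ∀ k ∈ K, ((a * k * a⁻¹ : F.aut P) : MulAut P) ∈ autS P := by
  obtain ⟨-, hfin, T, hT⟩ := hF.sylow P hP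
  obtain ⟨U, hU⟩ := (hK.map (QuotientGroup.mk' ((innAut P).subgroupOf (F.aut P)))).exists_le_sylow
  obtain ⟨g, hg⟩ := MulAction.exists_smul_eq (F.Out P) U T
  obtain ⟨a, rfl⟩ := QuotientGroup.mk'_surjective _ g
  refine ⟨a, fun k hk => mem_autS_of_mk_mem_outS ?_⟩
  rw [← hT, ← hg, map_mul, map_mul, map_inv]
  exact ⟨_, hU ⟨k, hk, rfl⟩, rfl⟩

theorem IsSaturated.exists_mulEquiv_congr_mem_autS (hF : F.IsSaturated p) (hS : IsPGroup p S)
    {P Q : Subgroup S} (hP : F.IsFullyNormalized p P) (h : F.IsConj Q P) :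
    ∃ e : Q ≃* P, e.toMonoidHom ∈ F.Hom Q P ∧ ∀ α ∈ autS Q, MulAut.congr e α ∈ autS P := by
  obtain ⟨e, he, he'⟩ := h
  let conjE : autS Q →* F.aut P :=
    ((MulAut.congr e).toMonoidHom.comp (autS Q).subtype).codRestrict _
      fun α => congr_mem_aut he he' (F.autS_le_aut Q α.2)
  obtain ⟨a, ha⟩ := hF.exists_conj_mem_autS hP
    ((isPGroup_autS hS Q).of_surjective _ conjE.rangeRestrict_surjective)
  exact ⟨e.trans a.1, F.comp_mem he a.2.1, fun α hα => ha (conjE ⟨α, hα⟩) ⟨_, rfl⟩⟩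

theorem IsSaturated.exists_normS_hom (hF : F.IsSaturated p) (hS : IsPGroup p S)
    {P Q : Subgroup S} (hP : F.IsFullyNormalized p P) (h : F.IsConj Q P) :
    ∃ ψ ∈ F.Hom (normS Q) (normS P), imageOn ψ Q = P := by
  obtain ⟨e, he, hα⟩ := hF.exists_mulEquiv_congr_mem_autS hS hP h
  let φ : Q →* (⊤ : Subgroup S) := (Subgroup.inclusion le_top).comp e.toMonoidHom
  have him : imageOf φ = P := imageOf_inclusion_comp_mulEquiv _ e
  have hdom : normS Q ≤ extDomain φ := normS_le_extDomain _ hα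
  obtain ⟨ψ, hψ, hψφ⟩ := hF.extend Q φ (F.comp_mem he (F.inclusion_mem _))
    (him.symm ▸ (hF.sylow P hP).1)
  let ψN : normS Q →* (⊤ : Subgroup S) := ψ.comp (Subgroup.inclusion hdom)
  have hψN : imageOn ψN Q = P := by
    rw [← imageOf_comp_inclusion _ (le_normS Q), ← him, ← hψφ]
    rfl
  obtain ⟨χ, hχ, hχψ⟩ := exists_lift (F.comp_mem (F.inclusion_mem hdom) hψ)
    (F.inclusion_mem (le_top (a := normS P))) (by
      rw [imageOf_inclusion, ← imageOn_self]
      exact (imageOn_normS ψN Q).trans_eq (congrArg normS hψN))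
  refine ⟨χ, hχ, Eq.trans ?_ hψN⟩
  rw [show ψN = _ from hχψ.symm]
  rfl

end FusionSystem

section Adjunctions

variable {C D : Type*} [Category* C] [Category* D] {G : D ⥤ C}

theorem exists_rightAdjoint_of_bijective {p : ∀ X Y, (G.obj Y ⟶ X) → Prop}
    (hex : ∀ X, ∃ Y η, p X Y η)
    (huniv : ∀ {X Y η}, p X Y η →
      ∀ Z, Function.Bijective fun g : Z ⟶ Y => G.map g ≫ η) :
    ∃ (R : C ⥤ D) (adj : G ⊣ R), ∀ X, p X (R.obj X) (adj.counit.app X) := by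
  choose R η hη using hex
  let e (Z : D) (X : C) : (G.obj Z ⟶ X) ≃ (Z ⟶ R X) :=
    (Equiv.ofBijective _ (huniv (hη X) Z)).symm
  have he (Z' Z : D) (X : C) (f : Z' ⟶ Z) (g : G.obj Z ⟶ X) :
      e Z' X (G.map f ≫ g) = f ≫ e Z X g := by
    obtain ⟨g, rfl⟩ := (e Z X).symm.surjective g
    refine ((e Z' X).eq_symm_apply).1 ?_
    simp [e]
  let adj := Adjunction.adjunctionOfEquivRight e he
  have hcounit (X : C) : adj.counit.app X = η X := by
    have : adj.counit.app X = (e _ _).symm (𝟙 (R X)) := by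
      simp [adj, Adjunction.adjunctionOfEquivRight]
    exact this.trans (by simp [e])
  exact ⟨_, adj, fun X => by rw [hcounit]; exact hη X⟩

theorem comp_rightAdjoint_eq_id {R : C ⥤ D} (adj : G ⊣ R) (hobj : ∀ Y, R.obj (G.obj Y) = Y)
    (hcounit : ∀ Y, G.map (eqToHom (hobj Y)) = adj.counit.app (G.obj Y)) : G ⋙ R = 𝟭 D := by
  refine CategoryTheory.Functor.ext hobj fun Y Z f => (adj.homEquiv _ _).symm.injective ?_
  rw [adj.homEquiv_counit, adj.homEquiv_counit]
  refine (adj.counit_naturality (G.map f)).trans ?_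
  rw [← hcounit, ← hcounit, ← G.map_comp, ← G.map_comp]
  simp

theorem functor_eq_of_comp_ι_eq {W : ObjectProperty D} {H K : C ⥤ W.FullSubcategory}
    (h : H ⋙ W.ι = K ⋙ W.ι) : H = K := by
  have hobj (X : C) : H.obj X = K.obj X := ObjectProperty.FullSubcategory.ext
    (Functor.congr_obj h X)
  refine CategoryTheory.Functor.ext hobj fun X Y f => W.ι.map_injective ?_
  have := Functor.congr_hom h f
  rw [Functor.comp_map, Functor.comp_map] at this
  rw [this, Functor.map_comp, Functor.map_comp, eqToHom_map, eqToHom_map]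

theorem under_eq_of_right_eq_eqToHom {A : C} {X Y : Under A} (f : X ⟶ Y)
    (h : X.right = Y.right) (hf : f.right = eqToHom h) : ∃ e : X = Y, f = eqToHom e := by
  have hw := Under.w f
  rw [hf] at hw
  obtain ⟨⟨⟨⟩⟩, B, x⟩ := X
  obtain ⟨⟨⟨⟩⟩, B', y⟩ := Y
  obtain rfl : B = B' := h
  obtain rfl : x = y := (Category.comp_id x).symm.trans hw
  exact ⟨rfl, Under.UnderMorphism.ext hf⟩

end Adjunctions

namespace CentricLinkingSystem

variable {S : Type u} [Group S] {F : FusionSystem S} {L : CentricLinkingSystem.{u, w} F}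

section Morphisms

theorem Obj.eq_of_grp_eq {P Q : L.Obj} (h : P.grp = Q.grp) : P = Q :=
  FusionSystem.CentricSubgroup.ext h

theorem proj_injective {P Q : L.Obj} (f : P ⟶ Q) : Function.Injective (proj f) :=
  F.injective (proj_mem f)

/-- The image of a morphism of `L`, as a subgroup of `S`. -/
abbrev im {P Q : L.Obj} (f : P ⟶ Q) : Subgroup S := imageOf (proj f)

theorem exists_proj_eq {P Q : L.Obj} {φ : P.grp →* Q.grp} (h : φ ∈ F.Hom P.grp Q.grp) :
    ∃ f : P ⟶ Q, proj f = φ := L.π_surj φ h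

/-- The distinguished monomorphism `P → Aut P`, with values in the automorphism group taken in the
category `L.Obj`. -/
def delta (P : L.Obj) : P.grp →* Aut P := L.δ P

theorem eq_delta_comp {P Q : L.Obj} {f g : P ⟶ Q} (h : proj f = proj g) :
    ∃ z ∈ Subgroup.center P.grp, g = (delta P z).hom ≫ f := (L.π_eq_iff f g).1 h

theorem eq_one_of_delta_comp {P Q : L.Obj} (f : P ⟶ Q) {z : P.grp}
    (hz : z ∈ Subgroup.center P.grp) (h : (delta P z).hom ≫ f = f) : z = 1 := L.free f z hz h

instance mono {P Q : L.Obj} (g : P ⟶ Q) : Mono g where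
  right_cancellation {R} f f' h := by
    have hp : proj f = proj f' := by
      have := congrArg proj h
      rw [proj_comp, proj_comp] at this
      exact (MonoidHom.cancel_left (proj_injective g)).1 this
    obtain ⟨z, hz, rfl⟩ := eq_delta_comp hp
    rw [Category.assoc] at h
    obtain rfl : z = 1 := eq_one_of_delta_comp (f ≫ g) hz h.symm
    rw [map_one]
    exact (Category.id_comp f).symm

theorem im_comp {P Q R : L.Obj} (f : P ⟶ Q) (g : Q ⟶ R) :
    im (f ≫ g) = imageOn (proj g) (im f) := by
  rw [im, proj_comp, imageOf_comp]

theorem im_comp_le {P Q R : L.Obj} (f : P ⟶ Q) (g : Q ⟶ R) : im (f ≫ g) ≤ im g := by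
  rw [im_comp, im, im, ← imageOn_self (proj g)]
  exact imageOn_mono _ (imageOf_le _)

theorem im_id (P : L.Obj) : im (𝟙 P) = P.grp := by
  rw [im, proj_id]
  exact imageOf_inclusion le_rfl

theorem im_of_isIso {P Q : L.Obj} (f : P ⟶ Q) [IsIso f] : im f = Q.grp := by
  refine le_antisymm (imageOf_le _) ?_
  have := im_comp_le (inv f) f
  rwa [IsIso.inv_hom_id, im_id] at this

theorem im_iso_comp {P Q R : L.Obj} (f : P ⟶ Q) [IsIso f] (g : Q ⟶ R) : im (f ≫ g) = im g := by
  rw [im_comp, im_of_isIso, imageOn_self]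

theorem exists_lift {P Q R : L.Obj} (f : P ⟶ R) (g : Q ⟶ R) (h : im f ≤ im g) :
    ∃ k : P ⟶ Q, k ≫ g = f := by
  obtain ⟨χ, hχ, hχg⟩ := FusionSystem.exists_lift (proj_mem f) (proj_mem g) h
  obtain ⟨k, rfl⟩ := exists_proj_eq hχ
  obtain ⟨z, -, rfl⟩ := eq_delta_comp (f := k ≫ g) (g := f) (by rw [proj_comp, hχg])
  exact ⟨(delta P z).hom ≫ k, Category.assoc _ _ _⟩

theorem exists_iso {P Q R : L.Obj} (f : P ⟶ R) (g : Q ⟶ R) (h : im f = im g) :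
    ∃ k : P ≅ Q, k.hom ≫ g = f := by
  obtain ⟨k, hk⟩ := exists_lift f g h.le
  obtain ⟨l, hl⟩ := exists_lift g f h.ge
  refine ⟨⟨k, l, ?_, ?_⟩, hk⟩
  · rw [← cancel_mono f, Category.assoc, hl, hk, Category.id_comp]
  · rw [← cancel_mono g, Category.assoc, hk, hl, Category.id_comp]

theorem isIso_of_im_eq {P Q : L.Obj} (f : P ⟶ Q) (h : im f = Q.grp) : IsIso f := by
  obtain ⟨k, hk⟩ := exists_iso f (𝟙 Q) (by rw [h, im_id])
  rw [← hk, Category.comp_id]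
  infer_instance

end Morphisms

namespace Inclusions

variable (I : L.Inclusions)

theorem im_ι {P Q : L.Obj} (h : P.grp ≤ Q.grp) : im (I.ι h) = P.grp := by
  rw [im, I.proj_ι, imageOf_inclusion]

theorem ι_eq_eqToHom {P Q : L.Obj} (h : P = Q) : I.ι (congrArg Obj.grp h).le = eqToHom h := by
  subst h
  exact I.ι_refl P

theorem im_ι_comp {P Q R : L.Obj} (h : P.grp ≤ Q.grp) (f : Q ⟶ R) :
    im (I.ι h ≫ f) = imageOn (proj f) P.grp := by
  rw [im_comp, im_ι]

end Inclusions

section Choices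

theorem nonempty_inclusions (P₀ : L.Obj) : Nonempty L.Inclusions := by
  -- Choose lifts into `S` and let `ι_P^Q` be the unique morphism through which that of `P` factors.
  let T : L.Obj := P₀.over ⊤ le_top
  have hT (P : L.Obj) : P.grp ≤ T.grp := le_top
  choose t ht using fun P : L.Obj => exists_proj_eq (F.inclusion_mem (hT P))
  have him (P : L.Obj) : im (t P) = P.grp := by rw [im, ht, imageOf_inclusion]
  have hlift {P Q : L.Obj} (h : P.grp ≤ Q.grp) : ∃ f : P ⟶ Q, f ≫ t Q = t P :=
    exists_lift _ _ (by rwa [him, him])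
  choose f hf using @hlift
  refine ⟨⟨@f, fun {P Q} h => ?_, fun P => ?_, fun {P Q R} h h' => ?_⟩⟩
  · have := congrArg proj (hf h)
    rw [proj_comp, ht, ht] at this
    exact (MonoidHom.cancel_left (Subgroup.inclusion_injective (hT Q))).1 this
  · rw [← cancel_mono (t P), hf, Category.id_comp]
  · rw [← cancel_mono (t R), Category.assoc, hf, hf, hf]

theorem exists_norm_hom {p : ℕ} [Fact p.Prime] (hF : F.IsSaturated p) (hS : IsPGroup p S)
    {P : L.Obj} (hP : F.IsFullyNormalized p P.grp) {A : L.Obj} (hA : F.IsConj A.grp P.grp) :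
    ∃ f : A.norm ⟶ P.norm, imageOn (proj f) A.grp = P.grp ∧
      ∀ h : A = P, f = eqToHom (congrArg Obj.norm h) := by
  by_cases h : A = P
  · subst h
    exact ⟨𝟙 _, by rw [proj_id]; exact FusionSystem.imageOn_id (le_normS _), fun _ => rfl⟩
  · obtain ⟨ψ, hψ, hψP⟩ := hF.exists_normS_hom hS hP hA
    obtain ⟨f, rfl⟩ := exists_proj_eq (P := A.norm) (Q := P.norm) hψ
    exact ⟨f, hψP, fun h' => (h h').elim⟩

theorem nonempty_retractionChoice {p : ℕ} [Fact p.Prime] (hF : F.IsSaturated p)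
    (hS : IsPGroup p S) {P : L.Obj} (hP : F.IsFullyNormalized p P.grp) :
    Nonempty (RetractionChoice P) := by
  choose f hf hf_id using fun φ : Under P => exists_norm_hom hF hS hP
    (A := imageObj φ.hom) (FusionSystem.isConj_imageOf (proj_mem φ.hom)).symm
  exact ⟨⟨f, hf, hf_id⟩⟩

end Choices

section NormUnder

variable {P : L.Obj}

theorem le_right_grp (σ : NormUnder P) : P.grp ≤ σ.right.grp := by
  intro x hx
  obtain ⟨⟨ψ, -, hψ⟩, him⟩ := σ.hom.2
  obtain ⟨y, hy, rfl⟩ := him.ge hx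
  exact (congrArg (· ∈ σ.right.grp) (hψ ⟨y, hy⟩)).mpr (ψ ⟨y, hy⟩).2

theorem NormObj.prod_grp {Q : NormObj P} (h : P.grp ≤ Q.grp) : Q.prod.grp = Q.grp :=
  sup_eq_left.2 h

theorem imageOn_proj_of_eq_eqToHom_comp {Q : NormObj P} {f : P.inNorm.prod ⟶ Q.prod}
    {k : P ⟶ Q.prod} (h : eqToHom P.eq_prod ≫ f = k) : imageOn (proj f) P.grp = im k := by
  rw [← h, im_comp, im_of_isIso]
  exact congrArg _ (congrArg Obj.grp P.eq_prod)

theorem isNormMor_of_imageOn_eq {Q R : NormObj P} (hR : P.grp ≤ R.grp) {φ : Q.prod ⟶ R.prod}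
    (h : imageOn (proj φ) P.grp = P.grp) : IsNormMor Q R φ :=
  ⟨⟨(Subgroup.inclusion (NormObj.prod_grp hR).le).comp
      ((proj φ).comp (Subgroup.inclusion Q.grp_le_prod)),
    ⟨F.comp_mem (F.comp_mem (F.inclusion_mem _) (proj_mem φ)) (F.inclusion_mem _),
      proj φ, proj_mem φ, fun _ => rfl, h⟩, fun _ => rfl⟩, h⟩

theorem exists_normUnder_hom_eq {T : NormObj P} (hT : P.grp ≤ T.grp) {k : P ⟶ T.prod}
    (hk : im k = P.grp) : ∃ g : P.inNorm ⟶ T, eqToHom P.eq_prod ≫ g.1 = k := by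
  have hcomp : eqToHom P.eq_prod ≫ eqToHom P.eq_prod.symm ≫ k = k := by simp
  exact ⟨⟨_, isNormMor_of_imageOn_eq hT ((imageOn_proj_of_eq_eqToHom_comp hcomp).trans hk)⟩, hcomp⟩

theorem im_underIncl_hom (σ : NormUnder P) : im ((underIncl P).obj σ).hom = P.grp :=
  (imageOn_proj_of_eq_eqToHom_comp rfl).symm.trans σ.hom.2.2

theorem imageOn_proj_right (σ : NormUnder P) {φ : Under P} (f : (underIncl P).obj σ ⟶ φ) :
    imageOn (proj f.right) P.grp = im φ.hom := by
  rw [← Under.w f, im_comp, im_underIncl_hom]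

instance (φ ψ : Under P) (f : φ ⟶ ψ) : Mono f :=
  (Under.forget P).mono_of_mono_map (inferInstanceAs (Mono f.right))

instance underIncl_faithful : (underIncl P).Faithful where
  map_injective h := Under.UnderMorphism.ext (Subtype.ext (congrArg (fun k => k.right) h))

instance underIncl_full : (underIncl P).Full where
  map_surjective {σ τ} f := by
    have hw : ((underIncl P).obj σ).hom ≫ f.right = ((underIncl P).obj τ).hom := Under.w f
    have him := (imageOn_proj_right σ f).trans (im_underIncl_hom τ)
    let g : σ.right ⟶ τ.right := ⟨f.right, isNormMor_of_imageOn_eq (le_right_grp τ) him⟩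
    have hg : eqToHom P.eq_prod ≫ σ.hom.1 ≫ f.right = eqToHom P.eq_prod ≫ τ.hom.1 :=
      (Category.assoc _ _ _).symm.trans hw
    exact ⟨Under.homMk g (Subtype.ext ((cancel_epi _).1 hg)), Under.UnderMorphism.ext rfl⟩

theorem underIncl_obj_injective : Function.Injective (underIncl P).obj := by
  intro σ τ h
  have hgrp : σ.right.prod.grp = τ.right.prod.grp := congrArg (fun X : Under P => X.right.grp) h
  rw [NormObj.prod_grp (le_right_grp σ), NormObj.prod_grp (le_right_grp τ)] at hgrp
  obtain ⟨⟨⟨⟩⟩, ⟨A, hA, hA'⟩, x⟩ := σ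
  obtain ⟨⟨⟨⟩⟩, ⟨B, hB, hB'⟩, y⟩ := τ
  obtain rfl : A = B := hgrp
  have hxy : eqToHom P.eq_prod ≫ x.1 = eqToHom P.eq_prod ≫ y.1 := by
    exact eq_of_heq (Comma.mk.inj h).2.2
  obtain rfl : x = y := Subtype.ext ((cancel_epi _).1 hxy)
  rfl

end NormUnder

section Retraction

variable {P : L.Obj}

theorem le_norm_grp (P : L.Obj) : P.grp ≤ P.norm.grp := le_normS P.grp

theorem normInObj_le_norm {P Q : L.Obj} (φ : P ⟶ Q) :
    (normInObj φ).grp ≤ (imageObj φ).norm.grp := inf_le_left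

theorem normInObj_le {P Q : L.Obj} (φ : P ⟶ Q) : (normInObj φ).grp ≤ Q.grp := inf_le_right

theorem imageObj_le_normInObj {P Q : L.Obj} (φ : P ⟶ Q) :
    (imageObj φ).grp ≤ (normInObj φ).grp := le_inf (le_normS _) (imageObj_le _)

/-- The object `T = f_φ(N_S(P_φ) ∩ Q)` of `N_L P`, the target of the retraction at `φ : P → Q`. -/
def RetractionChoice.target (c : RetractionChoice P) (φ : Under P) : NormObj P where
  grp := imageOn (proj (c.lift φ)) (normInObj φ.hom).grp
  le_norm := imageOn_le _ _
  centric := FusionSystem.IsCentric.isNormCentric (P.centric.of_le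
    ((c.image_eq φ).ge.trans (imageOn_mono _ (imageObj_le_normInObj φ.hom))))

theorem RetractionChoice.le_target (c : RetractionChoice P) (φ : Under P) :
    P.grp ≤ (c.target φ).grp :=
  (c.image_eq φ).ge.trans (imageOn_mono _ (imageObj_le_normInObj φ.hom))

variable {I : L.Inclusions} {c : RetractionChoice P}

-- The definition, with the inclusions between subgroups stated as inclusions between objects of
-- `L`, so that they can be composed by rewriting.
theorem isRetractionAt_iff {φ : Under P} {ρ : NormUnder P} {η : (underIncl P).obj ρ ⟶ φ} :
    IsRetractionAt I c φ ρ η ↔ ρ.right.grp = imageOn (proj (c.lift φ)) (normInObj φ.hom).grp ∧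
    ∃ (φ₀ : P ⟶ imageObj φ.hom) (F₁ : normInObj φ.hom ≅ ρ.right.prod) (F₂ : imageObj φ.hom ≅ P),
      φ₀ ≫ I.ι (imageObj_le φ.hom) = φ.hom ∧
      F₁.hom ≫ I.ι ρ.right.prod_le = I.ι (normInObj_le_norm φ.hom) ≫ c.lift φ ∧
      F₂.hom ≫ I.ι (le_norm_grp P) = I.ι (le_norm_grp (imageObj φ.hom)) ≫ c.lift φ ∧
      ((underIncl P).obj ρ).hom = φ₀ ≫ F₂.hom ≫ I.ι ρ.right.le_prod ∧
      η.right = F₁.inv ≫ I.ι (normInObj_le φ.hom) := Iff.rfl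

theorem im_right_of_isRetractionAt {φ : Under P} {ρ : NormUnder P}
    {η : (underIncl P).obj ρ ⟶ φ} (h : IsRetractionAt I c φ ρ η) :
    im η.right = (normInObj φ.hom).grp := by
  obtain ⟨-, φ₀, F₁, F₂, -, -, -, -, h⟩ := isRetractionAt_iff.1 h
  exact (congrArg im h).trans ((im_iso_comp F₁.inv _).trans (I.im_ι _))

theorem exists_isRetractionAt (I : L.Inclusions) (c : RetractionChoice P) (φ : Under P) :
    ∃ (ρ : NormUnder P) (η : (underIncl P).obj ρ ⟶ φ), IsRetractionAt I c φ ρ η := by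
  let T := c.target φ
  have hT : T.prod.grp = imageOn (proj (c.lift φ)) (normInObj φ.hom).grp :=
    NormObj.prod_grp (c.le_target φ)
  obtain ⟨φ₀, h₀⟩ := exists_iso φ.hom (I.ι (imageObj_le φ.hom)) (by rw [I.im_ι]; rfl)
  obtain ⟨F₁, h₁⟩ := exists_iso (I.ι (normInObj_le_norm φ.hom) ≫ c.lift φ) (I.ι T.prod_le)
    (by rw [I.im_ι_comp, I.im_ι, hT])
  obtain ⟨F₂, h₂⟩ := exists_iso (I.ι (le_norm_grp (imageObj φ.hom)) ≫ c.lift φ)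
    (I.ι (le_norm_grp P)) (by rw [I.im_ι_comp, I.im_ι, c.image_eq])
  have hcomm : F₂.hom ≫ I.ι T.le_prod = I.ι (imageObj_le_normInObj φ.hom) ≫ F₁.hom := by
    rw [← cancel_mono (I.ι T.prod_le), Category.assoc, Category.assoc, I.ι_trans, h₁, h₂,
      ← Category.assoc, I.ι_trans]
  obtain ⟨g, hg⟩ := exists_normUnder_hom_eq (c.le_target φ)
    (k := φ₀.hom ≫ F₂.hom ≫ I.ι T.le_prod) (by rw [im_iso_comp, im_iso_comp, I.im_ι])
  have hη : (eqToHom P.eq_prod ≫ g.1) ≫ F₁.inv ≫ I.ι (normInObj_le φ.hom) = φ.hom := by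
    refine Eq.trans ?_ h₀
    rw [hg, hcomm]
    simp only [Category.assoc, Iso.hom_inv_id_assoc, I.ι_trans]
  exact ⟨Under.mk g, Under.homMk (F₁.inv ≫ I.ι (normInObj_le φ.hom)) hη,
    isRetractionAt_iff.2 ⟨rfl, φ₀.hom, F₁, F₂, h₀, h₁, h₂, hg, rfl⟩⟩

theorem exists_map_comp_eq_of_isRetractionAt {φ : Under P} {ρ : NormUnder P}
    {η : (underIncl P).obj ρ ⟶ φ} (h : IsRetractionAt I c φ ρ η) {σ : NormUnder P}
    (f : (underIncl P).obj σ ⟶ φ) : ∃ g : σ ⟶ ρ, (underIncl P).map g ≫ η = f := by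
  -- The target of `σ` normalizes `P`, so its image under `f` normalizes `P_φ`.
  have hle : im f.right ≤ im η.right := by
    rw [im_right_of_isRetractionAt h]
    refine le_inf ?_ (imageOf_le _)
    calc im f.right = imageOn (proj f.right) σ.right.prod.grp := (imageOn_self _).symm
      _ ≤ imageOn (proj f.right) (normS P.grp) := imageOn_mono _ σ.right.prod_le
      _ ≤ normS (imageOn (proj f.right) P.grp) := imageOn_normS _ _
      _ = normS (im φ.hom) := by rw [imageOn_proj_right]
  obtain ⟨k, hk⟩ := exists_lift f.right η.right hle
  have hw : ((underIncl P).obj σ).hom ≫ k = ((underIncl P).obj ρ).hom := by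
    rw [← cancel_mono η.right, Category.assoc, hk]
    exact (Under.w f).trans (Under.w η).symm
  obtain ⟨g, hg⟩ := (underIncl P).map_surjective (Under.homMk k hw)
  exact ⟨g, by rw [hg]; exact Under.UnderMorphism.ext hk⟩

theorem bijective_of_isRetractionAt {φ : Under P} {ρ : NormUnder P}
    {η : (underIncl P).obj ρ ⟶ φ} (h : IsRetractionAt I c φ ρ η) (σ : NormUnder P) :
    Function.Bijective fun g : σ ⟶ ρ => (underIncl P).map g ≫ η :=
  ⟨fun _ _ hfg => (underIncl P).map_injective ((cancel_mono η).1 hfg),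
    exists_map_comp_eq_of_isRetractionAt h⟩

theorem exists_retraction (I : L.Inclusions) (c : RetractionChoice P) :
    ∃ (r : Under P ⥤ NormUnder P) (adj : underIncl P ⊣ r),
      ∀ φ : Under P, IsRetractionAt I c φ (r.obj φ) (adj.counit.app φ) :=
  exists_rightAdjoint_of_bijective (p := IsRetractionAt I c) (exists_isRetractionAt I c)
    bijective_of_isRetractionAt

theorem normInObj_underIncl_grp (σ : NormUnder P) :
    (normInObj ((underIncl P).obj σ).hom).grp = σ.right.prod.grp := by
  change normS (im ((underIncl P).obj σ).hom) ⊓ σ.right.prod.grp = _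
  rw [im_underIncl_hom]
  exact inf_eq_right.2 σ.right.prod_le

theorem eq_of_isRetractionAt {σ ρ : NormUnder P}
    {η : (underIncl P).obj ρ ⟶ (underIncl P).obj σ}
    (h : IsRetractionAt I c ((underIncl P).obj σ) ρ η) :
    ∃ e : ρ = σ, (underIncl P).map (eqToHom e) = η := by
  have hA : imageObj ((underIncl P).obj σ).hom = P := Obj.eq_of_grp_eq (im_underIncl_hom σ)
  have hlift : c.lift ((underIncl P).obj σ) = I.ι (congrArg Obj.grp (congrArg Obj.norm hA)).le := by
    rw [c.lift_eq_id _ hA, I.ι_eq_eqToHom (congrArg Obj.norm hA)]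
  have hN := normInObj_underIncl_grp σ
  obtain ⟨hT, φ₀, F₁, F₂, -, h₁, -, -, hη⟩ := isRetractionAt_iff.1 h
  have hρ : ρ.right.prod.grp = σ.right.prod.grp := by
    rw [NormObj.prod_grp (le_right_grp ρ), hT, hlift, I.proj_ι, imageOn_inclusion, hN]
    exact inf_le_left
  have hF₁ : F₁.hom = I.ι (hN.trans hρ.symm).le := by
    rw [hlift, I.ι_trans] at h₁
    rw [← cancel_mono (I.ι ρ.right.prod_le), h₁, I.ι_trans]
  have hηι : η.right = I.ι (P := ρ.right.prod) (Q := σ.right.prod) hρ.le := by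
    refine hη.trans ((Iso.inv_comp_eq F₁).2 ?_)
    rw [hF₁]
    exact (I.ι_trans _ _).symm
  have hobj : ρ.right.prod = σ.right.prod := Obj.eq_of_grp_eq hρ
  obtain ⟨e, rfl⟩ := under_eq_of_right_eq_eqToHom η hobj (hηι.trans (I.ι_eq_eqToHom hobj))
  obtain rfl := underIncl_obj_injective e
  exact ⟨rfl, (underIncl P).map_id ρ⟩

theorem underIncl_comp_retraction {r : Under P ⥤ NormUnder P} (adj : underIncl P ⊣ r)
    (h : ∀ φ : Under P, IsRetractionAt I c φ (r.obj φ) (adj.counit.app φ)) :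
    underIncl P ⋙ r = 𝟭 (NormUnder P) := by
  choose e he using fun σ => eq_of_isRetractionAt (h ((underIncl P).obj σ))
  exact comp_rightAdjoint_eq_id adj e he

theorem isIso_of_isRetractionAt {p : ℕ} [Fact p.Prime] (hS : IsDiscretePToral p S) {φ : Under P}
    {ρ : NormUnder P} {η : (underIncl P).obj ρ ⟶ φ} (h : IsRetractionAt I c φ ρ η)
    (hρ : IsIso ((underIncl P).obj ρ).hom) : IsIso φ.hom := by
  have hT : ρ.right.grp = P.grp := by
    rw [← im_underIncl_hom ρ, im_of_isIso]
    exact (NormObj.prod_grp (le_right_grp ρ)).symm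
  rw [h.1, ← c.image_eq φ] at hT
  have hN : (normInObj φ.hom).grp ≤ (imageObj φ.hom).grp :=
    le_of_imageOn_le (proj_injective _) inf_le_left hT.le
  exact isIso_of_im_eq φ.hom (hS.eq_of_normalizer_inf_le (imageObj_le φ.hom) hN)

end Retraction

section NonIso

variable {P : L.Obj} {r : Under P ⥤ NormUnder P}

theorem underInclNonIso_comp_restrictNonIso (hr : ∀ φ, nonIso P φ → normNonIso P (r.obj φ))
    (h : underIncl P ⋙ r = 𝟭 (NormUnder P)) :
    underInclNonIso P ⋙ restrictNonIso r hr = 𝟭 (NormUnderNonIso P) :=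
  functor_eq_of_comp_ι_eq (congrArg (fun G => (normNonIso P).ι ⋙ G) h)

/-- The restriction to non-isomorphisms of a natural transformation `i ∘ r ⇒ id`. -/
def natTransNonIso (hr : ∀ φ, nonIso P φ → normNonIso P (r.obj φ))
    (η : r ⋙ underIncl P ⟶ 𝟭 (Under P)) :
    restrictNonIso r hr ⋙ underInclNonIso P ⟶ 𝟭 (UnderNonIso P) where
  app φ := ObjectProperty.homMk (η.app φ.obj)
  naturality _ _ f := ObjectProperty.hom_ext _ (η.naturality f.hom)

end NonIso

end CentricLinkingSystem

theorem proposition3p1 {p : ℕ} [Fact p.Prime] {S : Type u} [Group S]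
    (hS : IsDiscretePToral p S) (F : FusionSystem S) (hF : F.IsSaturated p)
    (L : CentricLinkingSystem.{u, w} F) (P : L.Obj) (hP : F.IsFullyNormalized p P.grp) :
    Nonempty L.Inclusions ∧ Nonempty (RetractionChoice P) ∧
    ∀ (I : L.Inclusions) (c : RetractionChoice P),
      ∃ (r : Under P ⥤ NormUnder P) (η : r ⋙ underIncl P ⟶ 𝟭 (Under P)),
        (∀ φ : Under P, IsRetractionAt I c φ (r.obj φ) (η.app φ)) ∧
        underIncl P ⋙ r = 𝟭 (NormUnder P) ∧
        IsNerveEquivWithInverse r (underIncl P) ∧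
        ∃ hr : ∀ φ, nonIso P φ → normNonIso P (r.obj φ),
          underInclNonIso P ⋙ restrictNonIso r hr = 𝟭 (NormUnderNonIso P) ∧
          (∃ η' : restrictNonIso r hr ⋙ underInclNonIso P ⟶ 𝟭 (UnderNonIso P),
            ∀ φ : UnderNonIso P, (η'.app φ).hom = η.app φ.obj) ∧
          IsNerveEquivWithInverse (restrictNonIso r hr) (underInclNonIso P) := by
  refine ⟨nonempty_inclusions P, nonempty_retractionChoice hF hS.isPGroup hP, fun I c => ?_⟩
  obtain ⟨r, adj, h⟩ := exists_retraction I c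
  have hir := underIncl_comp_retraction adj h
  have hr (φ) (hφ : nonIso P φ) : normNonIso P (r.obj φ) :=
    fun hi => hφ (isIso_of_isRetractionAt hS (h φ) hi)
  have hir' := underInclNonIso_comp_restrictNonIso hr hir
  exact ⟨r, adj.counit, h, hir, isNerveEquivWithInverse_of_natTrans_of_comp_eq adj.counit hir,
    hr, hir', ⟨natTransNonIso hr adj.counit, fun _ => rfl⟩,
    isNerveEquivWithInverse_of_natTrans_of_comp_eq (natTransNonIso hr adj.counit) hir'⟩
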